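/- Consider a word RAM with word length of $w$ bits: a program is a fixed finite list of unit-cost instructions, independent of $w$, working on registers and memory words with values in $\{0,\ldots,2^w-1\}$, with constant loads, conditional jumps, memory loads and stores, addition, subtraction and multiplication modulo $2^w$, truncating division, left shift modulo $2^w$, right shift, bitwise AND, OR and XOR, and an instruction that loads an integer deviating from $\sqrt w$ by at most a fixed constant factor. Memory is not initialized. A clearable word array for universe size $n$ is a data structure that maintains a client sequence $(x_0,\ldots,x_{n-1})\in\{0,\ldots,2^w-1\}^n$, equal to $(0,\ldots,0)$ after the initialization (which is called with $n$), under the operations $\mathrm{read}(\ell)$, which returns $x_\ell$, and $\mathrm{write}(\ell,x)$, which replaces $x_\ell$ by $x$. It occupies $N$ bits if only these $N$ bits of memory carry information from one operation to the next and no other bits of memory are changed. Then there is a clearable word array (i.e. fixed programs for initialization, read and write, and a constant $C$, depending at most on the constant factor in the approximation of $\sqrt w$) such that the following holds for all $w$ and all positive integers $d$ and $t$ such that $d$ is a power of $2$ and $2dt\le w$: it can be initialized for universe size $n=d^t$ in at most $C$ steps (constant time), from then on occupies $nw+2$ bits, and, if given access to the parameters $d$ and $t$, supports read and write in at most $Ct$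 steps, i.e. in $O(t)$ time. -/

import Mathlib

/-! ### A word RAM with word length `w`

Words are elements of `BitVec w`. A program is a finite list of instructions that does not depend
on `w`. It uses registers, numbered by natural numbers (a fixed program mentions only finitely many
of them), and a memory area of `N` bits that has been allocated to it. -/

namespace WordRAM

/-- The binary word operations. -/
inductive BinOp where
  | add | sub | mul | div | shl | shr | and | or | xor

/-- The result of a binary operation: addition, subtraction, multiplication modulo `2 ^ w`,
truncating division (undefined for divisor `0`), left shift `(x * 2 ^ y) mod 2 ^ w`, right shift
`⌊x / 2 ^ y⌋`, and the bitwise operations. -/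
def BinOp.eval {w : ℕ} : BinOp → BitVec w → BitVec w → Option (BitVec w)
  | .add, x, y => some (x + y)
  | .sub, x, y => some (x - y)
  | .mul, x, y => some (x * y)
  | .div, x, y => if y = 0 then none else some (x / y)
  | .shl, x, y => some (x <<< y.toNat)
  | .shr, x, y => some (x >>> y.toNat)
  | .and, x, y => some (x &&& y)
  | .or, x, y => some (x ||| y)
  | .xor, x, y => some (x ^^^ y)

/-- The instructions. Register names and jump targets are natural numbers. -/
inductive Instr where
  /-- `const r k`: register `r` receives the constant `k` (modulo `2 ^ w`). -/
  | const (r k : ℕ)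
  /-- `sqrtW r`: register `r` receives the built-in approximation of `√w`. -/
  | sqrtW (r : ℕ)
  /-- `op o r a b`: register `r` receives the result of `o` on registers `a` and `b`. -/
  | op (o : BinOp) (r a b : ℕ)
  /-- `load r a`: register `r` receives the memory word whose address is in register `a`. -/
  | load (r a : ℕ)
  /-- `store a r`: the memory word whose address is in register `a` receives register `r`. -/
  | store (a r : ℕ)
  /-- `jmp l`: jump to instruction `l`. -/
  | jmp (l : ℕ)
  /-- `jeq a b l`: jump to instruction `l` if registers `a` and `b` are equal. -/
  | jeq (a b l : ℕ)
  /-- `jlt a b l`: jump to instruction `l` if register `a` is less than register `b`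
  (as unsigned integers). -/
  | jlt (a b l : ℕ)

/-- A program: a finite list of instructions, numbered from `0`. -/
abbrev Program := List Instr

/-- A memory: the word at every address. Addresses are relative to the beginning of the area
allocated to the program. -/
abbrev Memory (w : ℕ) := ℕ → BitVec w

/-- A configuration: program counter, registers, memory. -/
structure State (w : ℕ) where
  pc : ℕ
  reg : ℕ → BitVec w
  mem : Memory w

/-- Assign `x` to register `r` and proceed to the next instruction. -/
def State.assign {w : ℕ} (σ : State w) (r : ℕ) (x : BitVec w) : State w :=
  ⟨σ.pc + 1, Function.update σ.reg r x, σ.mem⟩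

/-- Proceed to instruction `l` if `b` holds, and to the next instruction otherwise. -/
def State.branch {w : ℕ} (σ : State w) (b : Prop) [Decidable b] (l : ℕ) : State w :=
  ⟨if b then l else σ.pc + 1, σ.reg, σ.mem⟩

/-- Execution of one instruction on a machine whose built-in approximation of `√w` is `s`, with an
allocated area of `N` bits. Only words that contain at least one of these bits, i.e., with an
address `a` such that `a * w < N`, may be accessed. The value is `none` after a division by zero
or an illegal memory access. -/
def exec {w : ℕ} (s : BitVec w) (N : ℕ) (σ : State w) : Instr → Option (State w)
  | .const r k => some (σ.assign r (BitVec.ofNat w k))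
  | .sqrtW r => some (σ.assign r s)
  | .op o r a b => (o.eval (σ.reg a) (σ.reg b)).map (σ.assign r)
  | .load r a =>
      if (σ.reg a).toNat * w < N then some (σ.assign r (σ.mem (σ.reg a).toNat)) else none
  | .store a r =>
      if (σ.reg a).toNat * w < N then
        some ⟨σ.pc + 1, σ.reg, Function.update σ.mem (σ.reg a).toNat (σ.reg r)⟩
      else none
  | .jmp l => some (σ.branch True l)
  | .jeq a b l => some (σ.branch (σ.reg a = σ.reg b) l)
  | .jlt a b l => some (σ.branch ((σ.reg a).toNat < (σ.reg b).toNat) l)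

/-- A configuration is final if its program counter has left the program. -/
def State.Final {w : ℕ} (p : Program) (σ : State w) : Prop := p[σ.pc]? = none

/-- One step of the program `p` (`none` if there is no next instruction or it fails). -/
def step {w : ℕ} (s : BitVec w) (N : ℕ) (p : Program) (σ : State w) : Option (State w) :=
  p[σ.pc]?.bind (exec s N σ)

/-- Exactly `k` steps of the program `p`. -/
def run {w : ℕ} (s : BitVec w) (N : ℕ) (p : Program) : ℕ → State w → Option (State w)
  | 0, σ => some σ
  | k + 1, σ => (step s N p σ).bind (run s N p k)

/-- The configuration in which a program starts: the arguments are in registers `0, 1, …`, and all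
other registers have the contents `junk`. -/
def start {w : ℕ} (args : List (BitVec w)) (junk : ℕ → BitVec w) (M : Memory w) : State w :=
  ⟨0, fun r => args.getD r (junk r), M⟩

/-- Bit number `i` of a memory: word `a` holds the bits `a * w, …, a * w + (w - 1)`, the least
significant one first. -/
def bit {w : ℕ} (M : Memory w) (i : ℕ) : Bool := (M (i / w)).getLsbD (i % w)

/-- Started with the given arguments on the memory `M`, whatever the contents of the remaining
registers, the program `p` terminates without failure within `T` steps, has not changed any bit
outside of its area, formed by the bits `0, …, N - 1`, and the final configuration satisfies
`Q`. -/
def Achieves {w : ℕ} (s : BitVec w) (N : ℕ) (p : Program) (T : ℕ) (args : List (BitVec w))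
    (M : Memory w) (Q : State w → Prop) : Prop :=
  ∀ junk : ℕ → BitVec w, ∃ k ≤ T, ∃ σ : State w,
    run s N p k (start args junk M) = some σ ∧ σ.Final p ∧
      (∀ i, N ≤ i → bit σ.mem i = bit M i) ∧ Q σ

/-- The word `s` deviates from `√w` by at most the factor `c`. -/
def ApproxSqrt {w : ℕ} (c : ℝ) (s : BitVec w) : Prop :=
  √(w : ℝ) ≤ c * (s.toNat : ℝ) ∧ (s.toNat : ℝ) ≤ c * √(w : ℝ)

end WordRAM

/-- The three programs of a data structure with initialization, reading and writing. -/
structure ArrayPrograms where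
  init : WordRAM.Program
  read : WordRAM.Program
  write : WordRAM.Program

/-- The programs `A`, on a word RAM with word length `w`, realize a clearable word array for
universe size `n` that occupies `N` bits, with worst-case times `Tinit`, `Tread` and `Twrite`.
`init` is called with `n` on an arbitrary memory; `read` and `write` are called with `params`
followed by their own arguments, and `read` returns its result in register `0`. The relation `Rep`
tells which client sequence is represented by a memory. It depends only on the `N` bits occupied,
so that no information is kept elsewhere between operations and other bits may be changed
arbitrarily between them; it holds for the all-zero sequence after the initialization and is
maintained by all subsequent operations. -/
def IsClearableWordArray {w : ℕ} (s : BitVec w) (A : ArrayPrograms) (n N : ℕ)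
    (params : List (BitVec w)) (Tinit Tread Twrite : ℕ) : Prop :=
  ∃ Rep : WordRAM.Memory w → (Fin n → BitVec w) → Prop,
    (∀ M M' x, (∀ i < N, WordRAM.bit M i = WordRAM.bit M' i) → Rep M x → Rep M' x) ∧
    (∀ M, WordRAM.Achieves s N A.init Tinit [BitVec.ofNat w n] M fun σ => Rep σ.mem fun _ => 0) ∧
    (∀ M x, Rep M x → ∀ l : Fin n,
      WordRAM.Achieves s N A.read Tread (params ++ [BitVec.ofNat w l]) M fun σ =>
        σ.reg 0 = x l ∧ Rep σ.mem x) ∧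
    (∀ M x, Rep M x → ∀ (l : Fin n) (y : BitVec w),
      WordRAM.Achieves s N A.write Twrite (params ++ [BitVec.ofNat w l, y]) M fun σ =>
        Rep σ.mem (Function.update x l y))

/-! Let `n = d ^ t`. The words `0, …, n - 1` are split into a left area of size `b` and a right
area. A left and a right word are paired if their lowest base-`n` digits point to each other. The
indices with value zero are the unpaired left and the paired right ones. An unpaired right word
stores its value directly. A paired left word has its value split: the part above `n * n` stays in
place, and the remainder modulo `n * n` lies in the partner above its pointer. This frees two digits
of the left word, one for the pointer and one that, in word `0`, records `b - 1`. Since `b - 1`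
cannot express `b = 0`, one flag bit in word `n` marks that case.

At first `b = n`: there is no right word, hence no pair, and everything is zero whatever the memory
contains. Rewriting a paired left or an unpaired right index needs only `chain` or `put`. Writing at
any other index `l` shrinks the left area by its last word, whose value moves to direct storage.
This frees a right word of value zero (`freed`): the former partner of that word, or that word
itself. If the freed word is `l`, it receives the new value directly. Otherwise a left `l` is paired
with it, whereas for a right `l` it replaces `l` as the partner of the left word paired with `l`,
after which `l` stores its value directly. Directly stored data may look like a pointer and form a
pair by accident; `put` then makes the left word point to itself.

The lemmas `decode_put`, `decode_chain` and `decode_pop` describe the effect on the represented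
values for every memory, so no invariant beyond `decode` is needed. They combine to
`decode_grow_left` and `decode_grow_right`. As `2 * d * t ≤ w` makes `n` a power of two with `n ^ 4
≤ 2 ^ w`, all digits fit. The only loop computes `d ^ t`, in `O(t)` steps; the rest is loop-free
code, verified by weakest preconditions over `ℕ` and transferred to the machine by
`Stmt.establishes`. -/

namespace WordRAM

/-! ### A small structured language on natural numbers and its compiler -/

/-- Arithmetic expressions over sixteen variables and the memory. -/
inductive Expr where
  | var (v : Fin 16)
  | lit (k : ℕ)
  | add (a b : Expr)
  | sub (a b : Expr)
  | mul (a b : Expr)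
  | div (a b : Expr)
  | load (a : Expr)

/-- The value of an expression, computed in `ℕ`. -/
def Expr.val (E : Fin 16 → ℕ) (W : ℕ → ℕ) : Expr → ℕ
  | .var v => E v
  | .lit k => k
  | .add a b => a.val E W + b.val E W
  | .sub a b => a.val E W - b.val E W
  | .mul a b => a.val E W * b.val E W
  | .div a b => a.val E W / b.val E W
  | .load a => W (a.val E W)

/-- The evaluation of an expression in `ℕ` does not leave `{0, …, B - 1}`, does not divide by zero,
and accesses only addresses up to `n`. -/
def Expr.Ok (B n : ℕ) (E : Fin 16 → ℕ) (W : ℕ → ℕ) : Expr → Prop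
  | .var _ => True
  | .lit k => k < B
  | .add a b => a.Ok B n E W ∧ b.Ok B n E W ∧ a.val E W + b.val E W < B
  | .sub a b => a.Ok B n E W ∧ b.Ok B n E W ∧ b.val E W ≤ a.val E W
  | .mul a b => a.Ok B n E W ∧ b.Ok B n E W ∧ a.val E W * b.val E W < B
  | .div a b => a.Ok B n E W ∧ b.Ok B n E W ∧ 0 < b.val E W
  | .load a => a.Ok B n E W ∧ a.val E W ≤ n

/-- Code that leaves the value of an expression in register `τ` and changes no smaller register. -/
def Expr.compile : Expr → ℕ → List Instr
  | .var v, τ => [.op .or τ v v]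
  | .lit k, τ => [.const τ k]
  | .add a b, τ => a.compile τ ++ b.compile (τ + 1) ++ [.op .add τ τ (τ + 1)]
  | .sub a b, τ => a.compile τ ++ b.compile (τ + 1) ++ [.op .sub τ τ (τ + 1)]
  | .mul a b, τ => a.compile τ ++ b.compile (τ + 1) ++ [.op .mul τ τ (τ + 1)]
  | .div a b, τ => a.compile τ ++ b.compile (τ + 1) ++ [.op .div τ τ (τ + 1)]
  | .load a, τ => a.compile τ ++ [.load τ τ]

/-- Loop-free statements. -/
inductive Stmt where
  | skip
  | set (v : Fin 16) (e : Expr)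
  | store (a e : Expr)
  | seq (p q : Stmt)
  | ifEq (a b : Expr) (p q : Stmt)
  | ifLt (a b : Expr) (p q : Stmt)

infixr:60 " ;; " => Stmt.seq

/-- The weakest precondition of a statement. -/
def Stmt.wp (B n : ℕ) : Stmt → ((Fin 16 → ℕ) → (ℕ → ℕ) → Prop) → (Fin 16 → ℕ) → (ℕ → ℕ) → Prop
  | .skip, Q, E, W => Q E W
  | .set v e, Q, E, W => e.Ok B n E W ∧ Q (Function.update E v (e.val E W)) W
  | .store a e, Q, E, W => a.Ok B n E W ∧ e.Ok B n E W ∧ a.val E W ≤ n ∧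
      Q E (Function.update W (a.val E W) (e.val E W))
  | .seq p q, Q, E, W => p.wp B n (q.wp B n Q) E W
  | .ifEq a b p q, Q, E, W => a.Ok B n E W ∧ b.Ok B n E W ∧
      (a.val E W = b.val E W → p.wp B n Q E W) ∧ (a.val E W ≠ b.val E W → q.wp B n Q E W)
  | .ifLt a b p q, Q, E, W => a.Ok B n E W ∧ b.Ok B n E W ∧
      (a.val E W < b.val E W → p.wp B n Q E W) ∧ (¬ a.val E W < b.val E W → q.wp B n Q E W)

/-- A conditional that executes `p` if the jump instruction `j` jumps, and `q` otherwise, placed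
at address `o`. -/
def condCode (o : ℕ) (j : ℕ → Instr) (p q : ℕ → List Instr) : List Instr :=
  let cq := q (o + 1)
  let cp := p (o + 1 + cq.length + 1)
  [j (o + 1 + cq.length + 1)] ++ cq ++ [.jmp (o + 1 + cq.length + 1 + cp.length)] ++ cp

/-- The code of a statement, placed at address `o`. -/
def Stmt.compile : Stmt → ℕ → List Instr
  | .skip, _ => []
  | .set v e, _ => e.compile 16 ++ [.op .or v 16 16]
  | .store a e, _ => a.compile 16 ++ e.compile 17 ++ [.store 16 17]
  | .seq p q, o => p.compile o ++ q.compile (o + (p.compile o).length)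
  | .ifEq a b p q, o =>
      let c := a.compile 16 ++ b.compile 17
      c ++ condCode (o + c.length) (.jeq 16 17) p.compile q.compile
  | .ifLt a b p q, o =>
      let c := a.compile 16 ++ b.compile 17
      c ++ condCode (o + c.length) (.jlt 16 17) p.compile q.compile

/-- `σ'` is reached from `σ` within `T` steps. -/
def Reaches {w : ℕ} (s : BitVec w) (N : ℕ) (p : Program) (T : ℕ) (σ σ' : State w) : Prop :=
  ∃ k ≤ T, run s N p k σ = some σ'

/-! ### Correctness of the compiler -/

section
variable {w : ℕ} {s : BitVec w} {N : ℕ} {p : Program}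

theorem run_add (k l : ℕ) (σ : State w) :
    run s N p (k + l) σ = (run s N p k σ).bind (run s N p l) := by
  induction k generalizing σ with
  | zero => simp [run]
  | succ k ih =>
    rw [Nat.succ_add]
    simp only [run]
    cases step s N p σ with
    | none => rfl
    | some τ => simp [ih]

theorem Reaches.refl (σ : State w) : Reaches s N p 0 σ σ := ⟨0, le_rfl, rfl⟩

theorem Reaches.trans {T T' : ℕ} {σ σ' σ'' : State w} (h : Reaches s N p T σ σ')
    (h' : Reaches s N p T' σ' σ'') : Reaches s N p (T + T') σ σ'' := by
  obtain ⟨k, hk, e⟩ := h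
  obtain ⟨l, hl, e'⟩ := h'
  exact ⟨k + l, by omega, by rw [run_add, e]; exact e'⟩

theorem Reaches.mono {T T' : ℕ} {σ σ' : State w} (h : Reaches s N p T σ σ') (hT : T ≤ T') :
    Reaches s N p T' σ σ' := by
  obtain ⟨k, hk, e⟩ := h
  exact ⟨k, by omega, e⟩

theorem Reaches.single {σ σ' : State w} {i : Instr} (hi : p[σ.pc]? = some i)
    (h : exec s N σ i = some σ') : Reaches s N p 1 σ σ' :=
  ⟨1, le_rfl, by simp [run, step, hi, h]⟩

/-- Code `c` at address `o` of the program `p`. -/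
def CodeAt (p : Program) (o : ℕ) (c : List Instr) : Prop :=
  ∃ pre post, p = pre ++ c ++ post ∧ pre.length = o

theorem CodeAt.left {o : ℕ} {c c' : List Instr} (h : CodeAt p o (c ++ c')) : CodeAt p o c := by
  obtain ⟨pre, post, rfl, rfl⟩ := h
  exact ⟨pre, c' ++ post, by simp, rfl⟩

theorem CodeAt.right {o : ℕ} {c c' : List Instr} (h : CodeAt p o (c ++ c')) :
    CodeAt p (o + c.length) c' := by
  obtain ⟨pre, post, rfl, rfl⟩ := h
  exact ⟨pre ++ c, post, by simp, by simp⟩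

theorem CodeAt.reaches {o : ℕ} {i : Instr} (h : CodeAt p o [i]) {reg : ℕ → BitVec w}
    {M : Memory w} {σ' : State w} (he : exec s N ⟨o, reg, M⟩ i = some σ') :
    Reaches s N p 1 ⟨o, reg, M⟩ σ' := by
  obtain ⟨pre, post, rfl, rfl⟩ := h
  exact Reaches.single (i := i) (by simp) he

/-- The contents of the first sixteen registers. -/
def env (reg : ℕ → BitVec w) (v : Fin 16) : ℕ := (reg v).toNat

/-- The contents of the memory. -/
def words (M : Memory w) (a : ℕ) : ℕ := (M a).toNat

/-- From address `o`, the code `c` reaches its end within `c.length` steps, leaves the value `x` in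
register `τ`, and changes neither the smaller registers nor the memory. -/
def Computes (s : BitVec w) (N : ℕ) (p : Program) (M : Memory w) (o : ℕ) (c : List Instr)
    (reg : ℕ → BitVec w) (τ x : ℕ) : Prop :=
  ∃ reg' : ℕ → BitVec w, Reaches s N p c.length ⟨o, reg, M⟩ ⟨o + c.length, reg', M⟩ ∧
    (reg' τ).toNat = x ∧ ∀ r < τ, reg' r = reg r

theorem env_congr {reg reg' : ℕ → BitVec w} {τ : ℕ} (hτ : 16 ≤ τ) (h : ∀ r < τ, reg' r = reg r) :
    env reg' = env reg := by
  funext v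
  simp only [env]
  rw [h _ (by omega)]

/-- Registers from `16` on serve as an evaluation stack: the second operand is computed from `τ + 1`
upwards and so cannot destroy the first one in `τ`. -/
theorem Computes.bin {M : Memory w} {o : ℕ} {c c' : List Instr} {reg : ℕ → BitVec w}
    {τ x y : ℕ} {f : BinOp} {z : ℕ}
    (hc : CodeAt p o (c ++ c' ++ [.op f τ τ (τ + 1)]))
    (h : Computes s N p M o c reg τ x)
    (h' : ∀ reg' : ℕ → BitVec w, (∀ r < τ, reg' r = reg r) →
      Computes s N p M (o + c.length) c' reg' (τ + 1) y)
    (hf : ∀ u v : BitVec w, u.toNat = x → v.toNat = y → ∃ r, f.eval u v = some r ∧ r.toNat = z) :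
    Computes s N p M o (c ++ c' ++ [.op f τ τ (τ + 1)]) reg τ z := by
  obtain ⟨r₁, e₁, v₁, k₁⟩ := h
  obtain ⟨r₂, e₂, v₂, k₂⟩ := h' r₁ k₁
  obtain ⟨r, hr, hz⟩ := hf (r₂ τ) (r₂ (τ + 1)) (by rw [k₂ _ (by omega)]; exact v₁) v₂
  refine ⟨Function.update r₂ τ r, ?_, by simpa using hz, fun q hq => ?_⟩
  · have h3 : Reaches s N p 1 ⟨o + (c ++ c').length, r₂, M⟩
        ⟨o + (c ++ c').length + 1, Function.update r₂ τ r, M⟩ :=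
      hc.right.reaches (by simp [exec, hr, State.assign])
    have := (e₁.trans e₂).trans (by simpa [Nat.add_assoc] using h3)
    simpa [Nat.add_assoc] using this
  · rw [Function.update_of_ne (by omega), k₂ _ (by omega), k₁ _ hq]

/-- `Expr.Ok` excludes overflow and underflow, so arithmetic modulo `2 ^ w` agrees with arithmetic
in `ℕ`. Addresses up to `n` are legal because word `n` contains the two extra bits. -/
theorem Expr.computes {n : ℕ} (hN : N = n * w + 2) (M : Memory w) (e : Expr) :
    ∀ (τ o : ℕ) (reg : ℕ → BitVec w), 16 ≤ τ → e.Ok (2 ^ w) n (env reg) (words M) →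
      CodeAt p o (e.compile τ) →
      Computes s N p M o (e.compile τ) reg τ (e.val (env reg) (words M)) := by
  induction e with
  | var v =>
    intro τ o reg hτ _ hc
    refine ⟨Function.update reg τ (reg v), ?_, by simp [Expr.val, env], fun r hr => ?_⟩
    · exact CodeAt.reaches hc (by simp [exec, BinOp.eval, State.assign, Expr.compile])
    · rw [Function.update_of_ne (by omega)]
  | lit k =>
    intro τ o reg hτ ok hc
    refine ⟨Function.update reg τ (BitVec.ofNat w k), ?_, ?_, fun r hr => ?_⟩
    · exact CodeAt.reaches hc (by simp [exec, State.assign, Expr.compile])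
    · simp only [Expr.Ok] at ok
      simp [Expr.val, Nat.mod_eq_of_lt ok]
    · rw [Function.update_of_ne (by omega)]
  | add a b iha ihb =>
    intro τ o reg hτ ok hc
    refine Computes.bin (y := b.val (env reg) (words M)) hc (iha τ o reg hτ ok.1 hc.left.left) (fun reg' h => ?_)
      fun u v hu hv => ⟨u + v, rfl, ?_⟩
    · have := env_congr hτ h
      rw [← this]
      exact ihb _ _ reg' (by omega) (by rw [this]; exact ok.2.1) hc.left.right
    · rw [BitVec.toNat_add, hu, hv]
      exact Nat.mod_eq_of_lt ok.2.2
  | sub a b iha ihb =>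
    intro τ o reg hτ ok hc
    refine Computes.bin (y := b.val (env reg) (words M)) hc (iha τ o reg hτ ok.1 hc.left.left) (fun reg' h => ?_)
      fun u v hu hv => ⟨u - v, rfl, ?_⟩
    · have := env_congr hτ h
      rw [← this]
      exact ihb _ _ reg' (by omega) (by rw [this]; exact ok.2.1) hc.left.right
    · rw [BitVec.toNat_sub_of_le (by rw [BitVec.le_def, hu, hv]; exact ok.2.2), hu, hv]
      rfl
  | mul a b iha ihb =>
    intro τ o reg hτ ok hc
    refine Computes.bin (y := b.val (env reg) (words M)) hc (iha τ o reg hτ ok.1 hc.left.left) (fun reg' h => ?_)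
      fun u v hu hv => ⟨u * v, rfl, ?_⟩
    · have := env_congr hτ h
      rw [← this]
      exact ihb _ _ reg' (by omega) (by rw [this]; exact ok.2.1) hc.left.right
    · rw [BitVec.toNat_mul, hu, hv]
      exact Nat.mod_eq_of_lt ok.2.2
  | div a b iha ihb =>
    intro τ o reg hτ ok hc
    refine Computes.bin (y := b.val (env reg) (words M)) hc (iha τ o reg hτ ok.1 hc.left.left) (fun reg' h => ?_)
      fun u v hu hv => ⟨u / v, ?_, ?_⟩
    · have := env_congr hτ h
      rw [← this]
      exact ihb _ _ reg' (by omega) (by rw [this]; exact ok.2.1) hc.left.right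
    · have h0 : v ≠ 0 := by
        rintro rfl
        have := ok.2.2
        simp at hv
        omega
      simp only [BinOp.eval, if_neg h0]
    · rw [BitVec.toNat_udiv, hu, hv]
      rfl
  | load a iha =>
    intro τ o reg hτ ok hc
    obtain ⟨r₁, e₁, v₁, k₁⟩ := iha τ o reg hτ ok.1 hc.left
    refine ⟨Function.update r₁ τ (M (r₁ τ).toNat), ?_, ?_, fun q hq => ?_⟩
    · have hlt : (r₁ τ).toNat * w < N := by
        rw [v₁, hN]
        have := Nat.mul_le_mul_right w ok.2
        omega
      have h2 : Reaches s N p 1 ⟨o + (a.compile τ).length, r₁, M⟩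
          ⟨o + (a.compile τ).length + 1, Function.update r₁ τ (M (r₁ τ).toNat), M⟩ :=
        hc.right.reaches (by simp [exec, hlt, State.assign])
      simpa [Expr.compile, Nat.add_assoc] using e₁.trans h2
    · simp [Expr.val, words, v₁]
    · rw [Function.update_of_ne (by omega), k₁ _ hq]

theorem Expr.computes_pair {n : ℕ} (hN : N = n * w + 2) {M : Memory w} {a b : Expr} {o : ℕ}
    {reg : ℕ → BitVec w} (ha : a.Ok (2 ^ w) n (env reg) (words M))
    (hb : b.Ok (2 ^ w) n (env reg) (words M))
    (hc : CodeAt p o (a.compile 16 ++ b.compile 17)) :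
    ∃ reg' : ℕ → BitVec w, Reaches s N p (a.compile 16 ++ b.compile 17).length ⟨o, reg, M⟩
      ⟨o + (a.compile 16 ++ b.compile 17).length, reg', M⟩ ∧
      (reg' 16).toNat = a.val (env reg) (words M) ∧ (reg' 17).toNat = b.val (env reg) (words M) ∧
      env reg' = env reg := by
  obtain ⟨r₁, e₁, v₁, k₁⟩ := a.computes (s := s) hN M 16 o reg le_rfl ha hc.left
  have h₁ := env_congr le_rfl k₁
  obtain ⟨r₂, e₂, v₂, k₂⟩ := b.computes (s := s) hN M 17 _ r₁ (by omega) (by rwa [h₁]) hc.right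
  refine ⟨r₂, ?_, ?_, by rw [v₂, h₁], (env_congr (by omega) k₂).trans h₁⟩
  · simpa [Nat.add_assoc] using e₁.trans e₂
  · rw [k₂ _ (by omega), v₁]

/-- From address `o`, the code `c` reaches its end within `c.length` steps, changes the memory at
most at addresses up to `n`, and establishes `Q`. -/
def Establishes (s : BitVec w) (N : ℕ) (p : Program) (n o : ℕ) (c : List Instr)
    (reg : ℕ → BitVec w) (M : Memory w) (Q : (Fin 16 → ℕ) → (ℕ → ℕ) → Prop) : Prop :=
  ∃ (reg' : ℕ → BitVec w) (M' : Memory w),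
    Reaches s N p c.length ⟨o, reg, M⟩ ⟨o + c.length, reg', M'⟩ ∧
      (∀ a, n < a → M' a = M a) ∧ Q (env reg') (words M')

/-- Either path runs through only one of the branches, so the code length bounds the number of
steps. The branches are assumed correct at every address because their position depends on the code
before them. -/
theorem condCode_establishes {n o : ℕ} {j : ℕ → Instr} {cp cq : ℕ → List Instr}
    {reg : ℕ → BitVec w} {M : Memory w} {Q : (Fin 16 → ℕ) → (ℕ → ℕ) → Prop} (b : Prop)
    [Decidable b] (hj : ∀ l, exec s N ⟨o, reg, M⟩ (j l) = some (State.branch ⟨o, reg, M⟩ b l))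
    (hc : CodeAt p o (condCode o j cp cq))
    (hp : b → ∀ o', CodeAt p o' (cp o') → Establishes s N p n o' (cp o') reg M Q)
    (hq : ¬ b → ∀ o', CodeAt p o' (cq o') → Establishes s N p n o' (cq o') reg M Q) :
    Establishes s N p n o (condCode o j cp cq) reg M Q := by
  have h1 := hc.left.left.left.reaches (s := s) (N := N) (hj _)
  have hcq := hc.left.left.right
  have hjmp := hc.left.right
  have hcp := hc.right
  simp only [condCode, List.length_append, List.length_singleton, ← Nat.add_assoc] at *
  by_cases hb : b
  · obtain ⟨r', M', e, k, q⟩ := hp hb _ hcp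
    refine ⟨r', M', ?_, k, q⟩
    simp only [State.branch, if_pos hb] at h1
    have h2 := (h1.trans e).mono
      (T' := 1 + (cq (o + 1)).length + 1 + (cp (o + 1 + (cq (o + 1)).length + 1)).length) (by omega)
    convert h2 using 2
    · simp; omega
    · simp; omega
  · obtain ⟨r', M', e, k, q⟩ := hq hb _ hcq
    refine ⟨r', M', ?_, k, q⟩
    simp only [State.branch, if_neg hb] at h1
    have h2 := (h1.trans e).trans (hjmp.reaches (s := s) (N := N) (reg := r') (M := M') rfl)
    simp only [State.branch, if_true] at h2
    have h3 := h2.mono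
      (T' := 1 + (cq (o + 1)).length + 1 + (cp (o + 1 + (cq (o + 1)).length + 1)).length) (by omega)
    convert h3 using 2
    · simp; omega
    · simp; omega

theorem Establishes.append {n o : ℕ} {c c' : List Instr} {reg reg' : ℕ → BitVec w}
    {M : Memory w} {Q : (Fin 16 → ℕ) → (ℕ → ℕ) → Prop}
    (h : Reaches s N p c.length ⟨o, reg, M⟩ ⟨o + c.length, reg', M⟩)
    (h' : Establishes s N p n (o + c.length) c' reg' M Q) :
    Establishes s N p n o (c ++ c') reg M Q := by
  obtain ⟨r', M', e, k, q⟩ := h'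
  exact ⟨r', M', by simpa [Nat.add_assoc] using h.trans e, k, q⟩

theorem env_update (reg : ℕ → BitVec w) (v : Fin 16) (x : BitVec w) :
    env (Function.update reg v x) = Function.update (env reg) v x.toNat := by
  funext u
  by_cases h : u = v
  · subst h; simp [env]
  · have : (u : ℕ) ≠ v := fun h' => h (Fin.ext h')
    simp [env, h, this]

theorem words_update (M : Memory w) (a : ℕ) (x : BitVec w) :
    words (Function.update M a x) = Function.update (words M) a x.toNat := by
  funext u
  by_cases h : u = a
  · subst h; simp [words]
  · simp [words, h]

/-- The compiler is correct. -/
theorem Stmt.establishes {n : ℕ} (hN : N = n * w + 2) (c : Stmt) :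
    ∀ (Q : (Fin 16 → ℕ) → (ℕ → ℕ) → Prop) (o : ℕ) (reg : ℕ → BitVec w) (M : Memory w),
      c.wp (2 ^ w) n Q (env reg) (words M) → CodeAt p o (c.compile o) →
      Establishes s N p n o (c.compile o) reg M Q := by
  induction c with
  | skip =>
    intro Q o reg M h _
    exact ⟨reg, M, by simpa [Stmt.compile] using Reaches.refl _, fun _ _ => rfl, h⟩
  | set v e =>
    intro Q o reg M h hc
    obtain ⟨r₁, e₁, v₁, k₁⟩ := e.computes (s := s) hN M 16 o reg le_rfl h.1 hc.left
    refine Establishes.append e₁ ⟨Function.update r₁ v (r₁ 16), M, ?_, fun _ _ => rfl, ?_⟩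
    · exact hc.right.reaches (by simp [exec, BinOp.eval, State.assign])
    · rw [env_update, v₁, env_congr le_rfl k₁]
      exact h.2
  | store a e =>
    intro Q o reg M h hc
    obtain ⟨r₁, e₁, va, ve, k₁⟩ := Expr.computes_pair (s := s) hN h.1 h.2.1 hc.left
    refine Establishes.append e₁ ⟨r₁, Function.update M (r₁ 16).toNat (r₁ 17), ?_, ?_, ?_⟩
    · have hlt : (r₁ 16).toNat * w < N := by
        rw [va, hN]
        have := Nat.mul_le_mul_right w h.2.2.1
        omega
      exact hc.right.reaches (by simp [exec, hlt])
    · intro i hi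
      have := h.2.2.1
      rw [Function.update_of_ne (by omega)]
    · rw [words_update, va, ve, k₁]
      exact h.2.2.2
  | seq q r ihq ihr =>
    intro Q o reg M h hc
    obtain ⟨r₁, M₁, e₁, k₁, h₁⟩ := ihq _ o reg M h hc.left
    obtain ⟨r₂, M₂, e₂, k₂, h₂⟩ := ihr _ _ r₁ M₁ h₁ hc.right
    refine ⟨r₂, M₂, ?_, fun a ha => (k₂ a ha).trans (k₁ a ha), h₂⟩
    simpa [Stmt.compile, Nat.add_assoc] using e₁.trans e₂
  | ifEq a b q r ihq ihr =>
    intro Q o reg M h hc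
    obtain ⟨r₁, e₁, va, vb, k₁⟩ := Expr.computes_pair (s := s) hN h.1 h.2.1 hc.left
    refine Establishes.append e₁ (condCode_establishes (r₁ 16 = r₁ 17) (fun _ => rfl) hc.right
      (fun hb o' => ihq Q o' r₁ M ?_) (fun hb o' => ihr Q o' r₁ M ?_))
    · rw [k₁]
      exact h.2.2.1 (by rw [← va, ← vb, hb])
    · rw [k₁]
      exact h.2.2.2 fun h' => hb (BitVec.eq_of_toNat_eq (by rw [va, vb, h']))
  | ifLt a b q r ihq ihr =>
    intro Q o reg M h hc
    obtain ⟨r₁, e₁, va, vb, k₁⟩ := Expr.computes_pair (s := s) hN h.1 h.2.1 hc.left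
    refine Establishes.append e₁ (condCode_establishes ((r₁ 16).toNat < (r₁ 17).toNat)
      (fun _ => rfl) hc.right (fun hb o' => ihq Q o' r₁ M ?_) (fun hb o' => ihr Q o' r₁ M ?_))
    · rw [k₁]
      exact h.2.2.1 (by rwa [← va, ← vb])
    · rw [k₁]
      exact h.2.2.2 (by rwa [← va, ← vb])

/-! ### Computing the universe size -/

/-- Sets register `4` to the power of register `0` whose exponent is register `1`. -/
def powProgram : Program :=
  [.const 4 1, .const 16 0, .const 17 1, .jeq 1 16 7, .op .mul 4 4 0, .op .sub 1 1 17, .jmp 3]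

/-- Register `4` is an accumulator, and the equation is between words, so intermediate products need
no bound. The condition `t < 2 ^ w` keeps the countdown from reading zero too early. -/
theorem pow_loop {post : List Instr} (M : Memory w) (d t : ℕ) :
    ∀ reg : ℕ → BitVec w, reg 0 = BitVec.ofNat w d → reg 1 = BitVec.ofNat w t → t < 2 ^ w →
      reg 16 = 0 → reg 17 = 1 →
      ∃ reg' : ℕ → BitVec w, Reaches s N (powProgram ++ post) (4 * t + 1) ⟨3, reg, M⟩ ⟨7, reg', M⟩ ∧
        reg' 4 = reg 4 * BitVec.ofNat w (d ^ t) ∧ reg' 2 = reg 2 ∧ reg' 3 = reg 3 := by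
  induction t with
  | zero =>
    intro reg h0 h1 _ hz _
    refine ⟨reg, ?_, by simp, rfl, rfl⟩
    exact Reaches.single (i := .jeq 1 16 7) (by simp [powProgram])
      (by simp [exec, State.branch, h1, hz])
  | succ t ih =>
    intro reg h0 h1 ht hz ho
    have hne : reg 1 ≠ reg 16 := by
      rw [h1, hz]
      intro h
      have := congrArg BitVec.toNat h
      rw [BitVec.toNat_ofNat, Nat.mod_eq_of_lt ht] at this
      simp at this
    have hdec : BitVec.ofNat w (t + 1) - 1#w = BitVec.ofNat w t := by
      have : BitVec.ofNat w (t + 1) = BitVec.ofNat w t + 1#w := by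
        rw [BitVec.ofNat_add]
      rw [this, BitVec.add_sub_cancel]
    obtain ⟨r', e, h4, h2, h3⟩ := ih
      (Function.update (Function.update reg 4 (reg 4 * reg 0)) 1 (BitVec.ofNat w t))
      (by simpa using h0) (by simp) (by omega) (by simpa using hz) (by simpa using ho)
    refine ⟨r', ?_, ?_, by simpa using h2, by simpa using h3⟩
    · have a1 : Reaches s N (powProgram ++ post) 1 ⟨3, reg, M⟩ ⟨4, reg, M⟩ :=
        Reaches.single (i := .jeq 1 16 7) (by simp [powProgram])
          (by simp [exec, State.branch, hne])
      have a2 : Reaches s N (powProgram ++ post) 1 ⟨4, reg, M⟩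
          ⟨5, Function.update reg 4 (reg 4 * reg 0), M⟩ :=
        Reaches.single (i := .op .mul 4 4 0) (by simp [powProgram])
          (by simp [exec, BinOp.eval, State.assign])
      have a3 : Reaches s N (powProgram ++ post) 1 ⟨5, Function.update reg 4 (reg 4 * reg 0), M⟩
          ⟨6, Function.update (Function.update reg 4 (reg 4 * reg 0)) 1 (BitVec.ofNat w t), M⟩ :=
        Reaches.single (i := .op .sub 1 1 17) (by simp [powProgram])
          (by simp [exec, BinOp.eval, State.assign, h1, ho, hdec])
      have a4 : Reaches s N (powProgram ++ post) 1
          ⟨6, Function.update (Function.update reg 4 (reg 4 * reg 0)) 1 (BitVec.ofNat w t), M⟩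
          ⟨3, Function.update (Function.update reg 4 (reg 4 * reg 0)) 1 (BitVec.ofNat w t), M⟩ :=
        Reaches.single (i := .jmp 3) (by simp [powProgram])
          (by simp [exec, State.branch])
      exact ((((a1.trans a2).trans a3).trans a4).trans e).mono (by omega)
    · rw [h4]
      simp [h0, pow_succ', BitVec.mul_assoc, BitVec.ofNat_mul]

theorem powProgram_reaches {post : List Instr} (M : Memory w) {d t : ℕ} (reg : ℕ → BitVec w)
    (h0 : reg 0 = BitVec.ofNat w d) (h1 : reg 1 = BitVec.ofNat w t) (ht : t < 2 ^ w) :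
    ∃ reg' : ℕ → BitVec w, Reaches s N (powProgram ++ post) (4 * t + 4) ⟨0, reg, M⟩ ⟨7, reg', M⟩ ∧
      reg' 4 = BitVec.ofNat w (d ^ t) ∧ reg' 2 = reg 2 ∧ reg' 3 = reg 3 := by
  have a1 : Reaches s N (powProgram ++ post) 1 ⟨0, reg, M⟩ ⟨1, Function.update reg 4 1, M⟩ :=
    Reaches.single (i := .const 4 1) (by simp [powProgram]) (by simp [exec, State.assign])
  have a2 : Reaches s N (powProgram ++ post) 1 ⟨1, Function.update reg 4 1, M⟩
      ⟨2, Function.update (Function.update reg 4 1) 16 0, M⟩ :=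
    Reaches.single (i := .const 16 0) (by simp [powProgram]) (by simp [exec, State.assign])
  have a3 : Reaches s N (powProgram ++ post) 1 ⟨2, Function.update (Function.update reg 4 1) 16 0, M⟩
      ⟨3, Function.update (Function.update (Function.update reg 4 1) 16 0) 17 1, M⟩ :=
    Reaches.single (i := .const 17 1) (by simp [powProgram]) (by simp [exec, State.assign])
  obtain ⟨r', e, h4, h2, h3⟩ := pow_loop (s := s) (N := N) (post := post) M d t
    (Function.update (Function.update (Function.update reg 4 1) 16 0) 17 1)
    (by simpa using h0) (by simpa using h1) ht (by simp) (by simp)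
  refine ⟨r', (((a1.trans a2).trans a3).trans e).mono (by omega), ?_, by simpa using h2,
    by simpa using h3⟩
  rw [h4]
  simp

end

end WordRAM

namespace ClearableArray

/-! ### The representation -/

/-- Among words `0, …, n - 1`, of which the first `b` form the left area, the left word `i` and the
right word `j` point to each other. -/
def Paired (n b : ℕ) (W : ℕ → ℕ) (i j : ℕ) : Prop :=
  i < b ∧ b ≤ j ∧ W i % n = j ∧ W j % n = i

instance (n b : ℕ) (W : ℕ → ℕ) (i j : ℕ) : Decidable (Paired n b W i j) := by
  unfold Paired; infer_instance

/-- The value represented at index `l`. The value of a paired left word is distributed over the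
pair; an unpaired right word stores its own value; all other values are zero. -/
def decode (n b : ℕ) (W : ℕ → ℕ) (l : ℕ) : ℕ :=
  if l < b then
    if Paired n b W l (W l % n) then W l / (n * n) * (n * n) + W (W l % n) / n else 0
  else if Paired n b W (W l % n) l then 0 else W l

/-- The size of the left area. -/
def leftSize (n : ℕ) (W : ℕ → ℕ) : ℕ := if W n % 2 = 1 then 0 else W 0 / n % n + 1

/-- Store `x` in the right word `l` and destroy the pair that this may have created. -/
def put (n b : ℕ) (W : ℕ → ℕ) (l x : ℕ) : ℕ → ℕ :=
  if x % n < b ∧ W (x % n) % n = l then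
    Function.update (Function.update W l x) (x % n) ((b - 1) * n + x % n)
  else Function.update W l x

/-- Form a pair of the left word `i` and the right word `f`, with value `y`. -/
def chain (n b : ℕ) (W : ℕ → ℕ) (i f y : ℕ) : ℕ → ℕ :=
  Function.update (Function.update W i (y / (n * n) * (n * n) + ((b - 1) * n + f))) f
    (y % (n * n) * n + i)

/-! ### Effect of the elementary updates on pairs and values -/

variable {n b : ℕ} {W : ℕ → ℕ}

theorem decode_of_paired_left {i j : ℕ} (h : Paired n b W i j) :
    decode n b W i = W i / (n * n) * (n * n) + W j / n := by
  obtain ⟨h1, h2, rfl, h4⟩ := h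
  simp [decode, Paired, *]

theorem decode_of_paired_right {i j : ℕ} (h : Paired n b W i j) : decode n b W j = 0 := by
  obtain ⟨h1, h2, h3, rfl⟩ := h
  simp [decode, Paired, *]

theorem decode_left_of_not_paired {i : ℕ} (hi : i < b) (h : ∀ j, ¬ Paired n b W i j) :
    decode n b W i = 0 := by
  simp [decode, hi, h]

theorem decode_right_of_not_paired {j : ℕ} (hj : b ≤ j) (h : ∀ i, ¬ Paired n b W i j) :
    decode n b W j = W j := by
  simp [decode, hj.not_gt, h]

theorem Paired.right_unique {i j k : ℕ} (h : Paired n b W i j) (h' : Paired n b W i k) : j = k :=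
  h.2.2.1.symm.trans h'.2.2.1

theorem Paired.left_unique {i j k : ℕ} (h : Paired n b W i k) (h' : Paired n b W j k) : i = j :=
  h.2.2.2.symm.trans h'.2.2.2

theorem Paired.lt (hn : 0 < n) {i j : ℕ} (h : Paired n b W i j) : i < n ∧ j < n :=
  ⟨h.2.2.2 ▸ Nat.mod_lt _ hn, h.2.2.1 ▸ Nat.mod_lt _ hn⟩

/-- `decode` depends only on the pairs, on the upper parts of the left words, and on the right
words. -/
theorem decode_congr {b b' : ℕ} {W W' : ℕ → ℕ} {l : ℕ} (hb : l < b ↔ l < b')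
    (hp : ∀ j, Paired n b W l j ↔ Paired n b' W' l j)
    (hp' : ∀ i, Paired n b W i l ↔ Paired n b' W' i l)
    (hv : ∀ j, Paired n b W l j → W l / (n * n) = W' l / (n * n) ∧ W j / n = W' j / n)
    (hw : b ≤ l → (∀ i, ¬ Paired n b W i l) → W l = W' l) :
    decode n b W l = decode n b' W' l := by
  by_cases hl : l < b
  · by_cases h : ∃ j, Paired n b W l j
    · obtain ⟨j, h⟩ := h
      rw [decode_of_paired_left h, decode_of_paired_left ((hp j).1 h), (hv j h).1, (hv j h).2]
    · push Not at h
      rw [decode_left_of_not_paired hl h, decode_left_of_not_paired (hb.1 hl)]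
      exact fun j hj => h j ((hp j).2 hj)
  · by_cases h : ∃ i, Paired n b W i l
    · obtain ⟨i, h⟩ := h
      rw [decode_of_paired_right h, decode_of_paired_right ((hp' i).1 h)]
    · push Not at h
      rw [decode_right_of_not_paired (not_lt.1 hl) h, decode_right_of_not_paired, hw (not_lt.1 hl) h]
      · exact not_lt.1 fun h' => hl (hb.2 h')
      · exact fun i hi => h i ((hp' i).2 hi)

/-- A pair containing the new right word `l` could only have the left word `x % n`. If that word
points back, it is redirected to itself, a left index, and so belongs to no pair. -/
theorem put_paired {l x : ℕ} (hl : b ≤ l) (i j : ℕ) :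
    Paired n b (put n b W l x) i j ↔ Paired n b W i j ∧ j ≠ l := by
  have hk : ((b - 1) * n + x % n) % n = x % n := by simp
  unfold put Paired
  split_ifs with h <;> grind [Function.update_apply]

theorem put_apply_of_ne {l x a : ℕ} (h : a ≠ l) (h' : ¬ (a < b ∧ W a % n = l)) :
    put n b W l x a = W a := by
  unfold put
  split_ifs <;> grind [Function.update_apply]

theorem put_apply_self {l x : ℕ} (hl : b ≤ l) : put n b W l x l = x := by
  unfold put
  split_ifs <;> grind [Function.update_apply]

/-- A former left partner of `l` loses its pair and its value. Callers therefore ensure that no such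
partner is left, or that its value is meant to be zero. -/
theorem decode_put {l x i : ℕ} (hl : b ≤ l) :
    decode n b (put n b W l x) i =
      if i = l then x else if Paired n b W i l then 0 else decode n b W i := by
  split_ifs with h h'
  · subst h
    rw [decode_right_of_not_paired hl fun k hk => ((put_paired hl _ _).1 hk).2 rfl,
      put_apply_self hl]
  · refine decode_left_of_not_paired h'.1 fun j hj => ?_
    rw [put_paired hl] at hj
    exact hj.2 (hj.1.right_unique h')
  · refine (decode_congr Iff.rfl ?_ ?_ ?_ ?_).symm
    · intro j
      rw [put_paired hl]
      exact ⟨fun hj => ⟨hj, by rintro rfl; exact h' hj⟩, And.left⟩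
    · intro j
      rw [put_paired hl]
      exact ⟨fun hj => ⟨hj, h⟩, And.left⟩
    · intro j hj
      have hjl : j ≠ l := by rintro rfl; exact h' hj
      rw [put_apply_of_ne h, put_apply_of_ne hjl]
      · simp
      · exact fun hh => absurd hj.2.1 (by omega)
      · exact fun hh => hjl (hj.2.2.1.symm.trans hh.2)
    · intro hi _
      rw [put_apply_of_ne h (by omega)]

theorem chain_paired {i f y : ℕ} (hi : i < b) (hf : b ≤ f) (hfn : f < n) (k j : ℕ) :
    Paired n b (chain n b W i f y) k j ↔
      (k = i ∧ j = f) ∨ (Paired n b W k j ∧ k ≠ i ∧ j ≠ f) := by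
  have h1 : (y / (n * n) * (n * n) + ((b - 1) * n + f)) % n = f := by
    have : y / (n * n) * (n * n) + ((b - 1) * n + f) = f + n * (y / (n * n) * n + (b - 1)) := by ring
    rw [this, Nat.add_mul_mod_self_left, Nat.mod_eq_of_lt hfn]
  have h2 : (y % (n * n) * n + i) % n = i := by
    rw [Nat.mul_add_mod_self_right, Nat.mod_eq_of_lt (by omega)]
  unfold chain Paired
  grind [Function.update_apply]

/-- The third and fourth cases concern the abandoned partners of `i` and `f`: the one of `i` exposes
its raw contents, the one of `f` becomes zero. The applications of this lemma show that neither case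
occurs. -/
theorem decode_chain (hn : 0 < n) {i f y k : ℕ} (hi : i < b) (hf : b ≤ f) (hfn : f < n)
    (hb : b ≤ n) :
    decode n b (chain n b W i f y) k =
      if k = i then y else if k = f then 0 else if Paired n b W i k then W k else
      if Paired n b W k f then 0 else decode n b W k := by
  have hp := chain_paired (W := W) (y := y) hi hf hfn
  have hne : i ≠ f := by omega
  have hif : Paired n b (chain n b W i f y) i f := (hp i f).2 (Or.inl ⟨rfl, rfl⟩)
  have hu : ∀ a, a ≠ i → a ≠ f → chain n b W i f y a = W a := by
    intro a h1 h2
    simp [chain, h1, h2]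
  split_ifs with h1 h2 h3 h4
  · subst h1
    rw [decode_of_paired_left hif]
    -- The size digit and the pointer together stay below `n * n`, so they do not disturb the upper
    -- part of `y`.
    have hlt : (b - 1) * n + f < n * n := by
      calc (b - 1) * n + f < (b - 1) * n + n := by omega
        _ = (b - 1 + 1) * n := by ring
        _ ≤ n * n := Nat.mul_le_mul_right n (by omega)
    have e1 : chain n b W k f y k = y / (n * n) * (n * n) + ((b - 1) * n + f) := by
      simp [chain, hne]
    have e2 : chain n b W k f y f = y % (n * n) * n + k := by simp [chain]
    have d1 : (y / (n * n) * (n * n) + ((b - 1) * n + f)) / (n * n) = y / (n * n) := by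
      rw [Nat.add_comm, Nat.add_mul_div_right _ _ (by positivity), Nat.div_eq_of_lt hlt,
        Nat.zero_add]
    have d2 : (y % (n * n) * n + k) / n = y % (n * n) := by
      rw [Nat.add_comm, Nat.add_mul_div_right _ _ hn, Nat.div_eq_of_lt (by omega), Nat.zero_add]
    rw [e1, e2, d1, d2]
    exact Nat.div_add_mod' y (n * n)
  · subst h2
    exact decode_of_paired_right hif
  · have hbk : b ≤ k := h3.2.1
    rw [decode_right_of_not_paired hbk, hu k h1 h2]
    intro a ha
    rcases (hp a k).1 ha with h | h
    · exact h2 h.2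
    · exact h.2.1 (h.1.left_unique h3)
  · refine decode_left_of_not_paired h4.1 fun a ha => ?_
    rcases (hp k a).1 ha with h | h
    · exact h1 h.1
    · exact h.2.2 (h.1.right_unique h4)
  · refine (decode_congr Iff.rfl ?_ ?_ ?_ ?_).symm
    · intro j
      rw [hp]
      constructor
      · exact fun hj => Or.inr ⟨hj, h1, by rintro rfl; exact h4 hj⟩
      · rintro (h | h)
        · exact absurd h.1 h1
        · exact h.1
    · intro j
      rw [hp]
      constructor
      · exact fun hj => Or.inr ⟨hj, by rintro rfl; exact h3 hj, h2⟩
      · rintro (h | h)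
        · exact absurd h.2 h2
        · exact h.1
    · intro j hj
      rw [hu k h1 h2, hu j]
      · simp
      · rintro rfl; exact absurd hj.2.1 (by omega)
      · rintro rfl; exact h4 hj
    · intro _ _
      rw [hu k h1 h2]

/-- The right word that becomes free when the last left word moves to the right area. -/
def freed (n b : ℕ) (W : ℕ → ℕ) : ℕ :=
  if Paired n (b + 1) W b (W b % n) then W b % n else b

/-- `W₁` agrees with `W` up to the middle digits of the left words. -/
def SameUpToDigit (n b : ℕ) (W W₁ : ℕ → ℕ) : Prop :=
  (∀ a < n, W₁ a % n = W a % n) ∧ (∀ a < b, W₁ a / (n * n) = W a / (n * n)) ∧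
    ∀ a < n, b ≤ a → W₁ a = W a

theorem SameUpToDigit.paired (hn : 0 < n) {W₁ : ℕ → ℕ} (h : SameUpToDigit n b W W₁) (i j : ℕ) :
    Paired n b W₁ i j ↔ Paired n b W i j := by
  have := h.1
  constructor
  · intro hp
    have := hp.lt hn
    simpa [Paired, h.1 i this.1, h.1 j this.2] using hp
  · intro hp
    have := hp.lt hn
    simpa [Paired, h.1 i this.1, h.1 j this.2] using hp

theorem le_freed : b ≤ freed n b W := by
  unfold freed
  split_ifs with h
  · have := h.2.1; omega
  · exact le_rfl

theorem freed_lt (hb : b < n) : freed n b W < n := by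
  unfold freed
  split_ifs
  · exact Nat.mod_lt _ (by omega)
  · exact hb

/-- Moving the last left word to the right area. -/
theorem decode_pop (hn : 0 < n) {W₁ : ℕ → ℕ} (h : SameUpToDigit n b W W₁) {i : ℕ} (hi : i < n)
    (hif : i ≠ freed n b W) :
    decode n b (put n b W₁ b (decode n (b + 1) W b)) i = decode n (b + 1) W i := by
  rw [decode_put le_rfl]
  split_ifs with h1 h2
  · rw [h1]
  -- Here `i` points to `b` and back, but before the move `b` was itself a left index. So `i` was
  -- unpaired and zero, and destroying the accidental pair is right.
  · rw [h.paired hn] at h2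
    refine (decode_left_of_not_paired (by have := h2.1; omega) fun j hj => ?_).symm
    have := hj.2.1
    have := hj.2.2.1
    have := h2.2.2.1
    omega
  · rw [h.paired hn] at h2
    -- The two notions of pair differ only where `b` takes part. A pair of `b` with `i` on its right
    -- is excluded by `i ≠ freed n b W`, one with `i` on its left by `h2`.
    have key : ∀ u v, u = i ∨ v = i → (Paired n b W₁ u v ↔ Paired n (b + 1) W u v) := by
      intro u v huv
      rw [h.paired hn]
      unfold freed at hif
      unfold Paired at *
      grind
    refine decode_congr (by omega) (fun j => key i j (Or.inl rfl)) (fun j => key j i (Or.inr rfl))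
      ?_ ?_
    · intro j hj
      exact ⟨h.2.1 i hj.1, by rw [h.2.2 j (hj.lt hn).2 hj.2.1]⟩
    · intro hbi _
      exact h.2.2 i hi hbi

theorem decode_freed : decode n (b + 1) W (freed n b W) = 0 := by
  unfold freed
  split_ifs with h
  · exact decode_of_paired_right h
  · refine decode_left_of_not_paired (by omega) fun j hj => h ?_
    rw [hj.2.2.1]
    exact hj

/-- A former partner of `b` points to `b`, which is no longer a left index, so it cannot be in a new
pair. -/
theorem eq_of_paired_freed {a : ℕ} (h : Paired n b W a (freed n b W)) : freed n b W = b := by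
  unfold freed at *
  unfold Paired at *
  grind

theorem freed_of_paired {j : ℕ} (h : Paired n (b + 1) W b j) : freed n b W = j := by
  have h' := h.2.2.1
  unfold freed
  rw [if_pos (by rw [h']; exact h), h']

theorem freed_of_not_paired (h : ∀ j, ¬ Paired n (b + 1) W b j) : freed n b W = b := by
  unfold freed
  rw [if_neg (h _)]

/-- The memory after writing `x` at a so far unwritten index `l`, where, after `l` has been
written, `y` is the value at the left index `i`. -/
def grow (n b : ℕ) (W W₁ : ℕ → ℕ) (l x i y : ℕ) : ℕ → ℕ :=
  let W₂ := put n b W₁ b (decode n (b + 1) W b)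
  let W₃ := if freed n b W = l then W₂ else chain n b W₂ i (freed n b W) y
  if l < b then W₃ else put n b W₃ l x

/-- If `l = b`, the written word itself moves to the right area and takes `x` directly. Otherwise it
remains left and is paired with the freed word. -/
theorem decode_grow_left (hn : 0 < n) (hb : b < n) {W₁ : ℕ → ℕ} (h : SameUpToDigit n b W W₁)
    {l x a : ℕ} (ha : a < n) (hl : l < b + 1) (hlp : ∀ j, ¬ Paired n (b + 1) W l j) :
    decode n b (grow n b W W₁ l x l x) a = if a = l then x else decode n (b + 1) W a := by
  have hp : ∀ u v, Paired n b (put n b W₁ b (decode n (b + 1) W b)) u v ↔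
      Paired n b W u v ∧ v ≠ b := fun u v => by rw [put_paired le_rfl, h.paired hn]
  have hpop := decode_pop hn h ha
  rcases (Nat.lt_succ_iff_lt_or_eq.1 hl).symm with rfl | hlb
  · have hf := freed_of_not_paired hlp
    simp only [grow, hf, if_true, lt_irrefl, if_false]
    rw [decode_put le_rfl]
    split_ifs with h1 h2
    · rfl
    · exact absurd rfl ((hp _ _).1 h2).2
    · exact hpop (by rwa [hf])
  · have hf := le_freed (n := n) (b := b) (W := W)
    simp only [grow, if_pos hlb]
    rw [if_neg (by omega), decode_chain hn hlb hf (freed_lt hb) hb.le]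
    split_ifs with h1 h2 h3 h4
    · rfl
    · rw [h2, decode_freed]
    · have := (hp _ _).1 h3
      exact absurd ⟨hl, by have := this.1.2.1; omega, this.1.2.2⟩ (hlp a)
    · have := (hp _ _).1 h4
      exact absurd (eq_of_paired_freed this.1) this.2
    · exact hpop h2

/-- The freed word takes over the role of `l` as partner of `i`, after which `l` can hold `x`
directly. If the freed word is `l`, then `i = b` has just moved its own value and no new pair is
needed. -/
theorem decode_grow_right (hn : 0 < n) (hb : b < n) {W₁ : ℕ → ℕ} (h : SameUpToDigit n b W W₁)
    {l x i a : ℕ} (ha : a < n) (hil : Paired n (b + 1) W i l) :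
    decode n b (grow n b W W₁ l x i (decode n (b + 1) W i)) a =
      if a = l then x else decode n (b + 1) W a := by
  have hp : ∀ u v, Paired n b (put n b W₁ b (decode n (b + 1) W b)) u v ↔
      Paired n b W u v ∧ v ≠ b := fun u v => by rw [put_paired le_rfl, h.paired hn]
  have hpop := decode_pop hn h ha
  have hbl : b + 1 ≤ l := hil.2.1
  by_cases hfl : freed n b W = l
  · simp only [grow, hfl, if_true]
    rw [if_neg (by omega), decode_put (by omega)]
    split_ifs with h1 h2
    · rfl
    · have h3 := ((hp _ _).1 h2).1
      rw [← hfl] at h3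
      have := eq_of_paired_freed h3
      omega
    · exact hpop (by rwa [hfl])
  · have hib : i < b := by
      refine lt_of_le_of_ne (by have := hil.1; omega) ?_
      rintro rfl
      exact hfl (freed_of_paired hil)
    have hf := le_freed (n := n) (b := b) (W := W)
    simp only [grow, if_neg hfl]
    rw [if_neg (by omega), decode_put (by omega), decode_chain hn hib hf (freed_lt hb) hb.le]
    split_ifs with h1 h2 h3 h4 h5 h6
    · rfl
    · rcases (chain_paired hib hf (freed_lt hb) _ _).1 h2 with h3 | h3
      · exact absurd h3.2.symm hfl
      · exact absurd (((hp _ _).1 h3.1).1.2.2.2.symm.trans hil.2.2.2) h3.2.1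
    · rw [h3]
    · rw [h4, decode_freed]
    · have := ((hp _ _).1 h5).1.2.2.1
      exact absurd (this.symm.trans hil.2.2.1) h1
    · have := (hp _ _).1 h6
      exact absurd (eq_of_paired_freed this.1) this.2
    · exact hpop h4

theorem decode_chain_of_paired (hn : 0 < n) {i j y k : ℕ} (h : Paired n b W i j) (hb : b ≤ n) :
    decode n b (chain n b W i j y) k = if k = i then y else decode n b W k := by
  rw [decode_chain hn h.1 h.2.1 (h.lt hn).2 hb]
  split_ifs with h1 h2 h3 h4
  · rfl
  · rw [h2, decode_of_paired_right h]
  · exact absurd (h3.right_unique h) h2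
  · exact absurd (h4.left_unique h) h1
  · rfl

theorem decode_put_of_not_paired {l x k : ℕ} (hl : b ≤ l) (h : ∀ i, ¬ Paired n b W i l) :
    decode n b (put n b W l x) k = if k = l then x else decode n b W k := by
  rw [decode_put hl, if_neg (h k)]

/-! ### The size of the left area -/

theorem leftSize_le (hn : 0 < n) : leftSize n W ≤ n := by
  unfold leftSize
  split_ifs
  · omega
  · exact Nat.mod_lt _ hn

/-- Every left word written by `put` or `chain` gets `b - 1` as its middle digit, so the size
survives when that word happens to be word `0`. -/
theorem middle_digit {q f k : ℕ} (hf : f < n) (hk : k < n) :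
    (q * (n * n) + (f * n + k)) / n % n = f := by
  have : q * (n * n) + (f * n + k) = k + n * (f + n * q) := by ring
  rw [this, Nat.add_mul_div_left _ _ (by omega), Nat.div_eq_of_lt hk, Nat.zero_add,
    Nat.add_mul_mod_self_left, Nat.mod_eq_of_lt hf]

theorem leftSize_congr {W' : ℕ → ℕ} (hW : W' n = W n)
    (h : 0 < leftSize n W → W' 0 / n % n + 1 = leftSize n W) : leftSize n W' = leftSize n W := by
  unfold leftSize at *
  rw [hW]
  split_ifs at * with h1
  · rfl
  · exact h (by omega)

theorem leftSize_put (hn : 0 < n) {l x : ℕ} (hb : leftSize n W = b) (hl : b ≤ l) (hln : l < n) :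
    leftSize n (put n b W l x) = b := by
  have hbn : b ≤ n := hb ▸ leftSize_le hn
  conv_rhs => rw [← hb]
  refine leftSize_congr (put_apply_of_ne (by omega) (by omega)) fun hpos => ?_
  rw [hb] at hpos ⊢
  have h0 : (0 : ℕ) ≠ l := by omega
  unfold put
  split_ifs with h
  · by_cases hk : x % n = 0
    · have := middle_digit (q := 0) (show b - 1 < n by omega) hn
      simp only [zero_mul, zero_add] at this
      simp only [hk, Function.update_self]
      omega
    · rw [Function.update_of_ne (Ne.symm hk), Function.update_of_ne h0]
      unfold leftSize at hb
      split_ifs at hb <;> omega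
  · rw [Function.update_of_ne h0]
    unfold leftSize at hb
    split_ifs at hb <;> omega

theorem leftSize_chain (hn : 0 < n) {i f y : ℕ} (hb : leftSize n W = b) (hi : i < b) (hf : b ≤ f)
    (hfn : f < n) : leftSize n (chain n b W i f y) = b := by
  have hbn : b ≤ n := hb ▸ leftSize_le hn
  conv_rhs => rw [← hb]
  have hn1 : n ≠ f := by omega
  have hn2 : n ≠ i := by omega
  refine leftSize_congr (by simp [chain, hn1, hn2]) fun hpos => ?_
  rw [hb] at hpos ⊢
  have h0 : (0 : ℕ) ≠ f := by omega
  unfold chain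
  rw [Function.update_of_ne h0]
  by_cases hk : i = 0
  · rw [hk, Function.update_self, middle_digit (by omega) hfn]
    omega
  · rw [Function.update_of_ne (Ne.symm hk)]
    unfold leftSize at hb
    split_ifs at hb <;> omega

theorem sameUpToDigit_of_forall {W₁ : ℕ → ℕ} (h : ∀ a < n, W₁ a = W a) (hb : b ≤ n) :
    SameUpToDigit n b W W₁ :=
  ⟨fun a ha => by rw [h a ha], fun a ha => by rw [h a (by omega)], fun a ha _ => h a ha⟩

/-- The memory after decreasing the size of the left area to `b`. -/
def shrink (n b : ℕ) (W : ℕ → ℕ) : ℕ → ℕ :=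
  if b = 0 then Function.update W n (W n - W n % 2 + 1) else Function.update W 0 (W 0 - n)

theorem le_of_leftSize (hb : leftSize n W = b + 1) (h0 : b ≠ 0) : n ≤ W 0 := by
  unfold leftSize at hb
  by_contra hlt
  split_ifs at hb
  rw [Nat.div_eq_of_lt (by omega), Nat.zero_mod] at hb
  omega

/-- The middle digit of word `0` is `b`. When `b ≠ 0`, subtracting `n` decreases it without a
borrow; when `b = 0`, only the flag changes. -/
theorem sameUpToDigit_shrink (hn : 0 < n) (hb : leftSize n W = b + 1) :
    SameUpToDigit n b W (shrink n b W) := by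
  have hbn : b + 1 ≤ n := hb ▸ leftSize_le hn
  unfold shrink
  split_ifs with h0
  · refine sameUpToDigit_of_forall (fun a ha => ?_) (by omega)
    rw [Function.update_of_ne (by omega)]
  · have hle := le_of_leftSize hb h0
    have hdig : W 0 / n % n = b := by
      unfold leftSize at hb
      split_ifs at hb
      omega
    have hsub : (W 0 - n) / (n * n) = W 0 / (n * n) := by
      rw [← Nat.div_div_eq_div_mul, ← Nat.div_div_eq_div_mul]
      have h1 : (W 0 - n) / n = W 0 / n - 1 := by
        have := Nat.sub_mul_div (a := W 0) (b := n) (c := 1)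
        simpa using this
      rw [h1]
      have h2 := Nat.div_add_mod (W 0 / n) n
      have h3 : W 0 / n - 1 = (b - 1) + n * (W 0 / n / n) := by omega
      rw [h3, Nat.add_mul_div_left _ _ hn, Nat.div_eq_of_lt (by omega), Nat.zero_add]
    refine ⟨fun a ha => ?_, fun a ha => ?_, fun a ha hba => ?_⟩
    · by_cases h : a = 0
      · subst h
        rw [Function.update_self]
        exact (Nat.mod_eq_sub_mod hle).symm
      · rw [Function.update_of_ne h]
    · by_cases h : a = 0
      · subst h
        rw [Function.update_self, hsub]
      · rw [Function.update_of_ne h]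
    · rw [Function.update_of_ne (by omega)]

theorem leftSize_shrink (hn : 0 < n) (hb : leftSize n W = b + 1) :
    leftSize n (shrink n b W) = b := by
  have hbn : b + 1 ≤ n := hb ▸ leftSize_le hn
  unfold shrink
  split_ifs with h0
  · subst h0
    unfold leftSize
    rw [Function.update_self, if_pos (by omega)]
  · have hle := le_of_leftSize hb h0
    unfold leftSize at *
    rw [Function.update_of_ne (by omega), Function.update_self]
    split_ifs at * with h1
    have h1 : (W 0 - n) / n = W 0 / n - 1 := by
      have := Nat.sub_mul_div (a := W 0) (b := n) (c := 1)
      simpa using this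
    have h2 := Nat.div_add_mod (W 0 / n) n
    have h3 : W 0 / n - 1 = (b - 1) + n * (W 0 / n / n) := by omega
    rw [h1, h3, Nat.add_mul_mod_self_left, Nat.mod_eq_of_lt (by omega)]
    omega

end ClearableArray

/-! ### Bounds on the words, and the programs -/

namespace ClearableArray
open WordRAM

/-- The words `0, …, B - 1` are large enough for a universe of size `n`. -/
structure Roomy (n B : ℕ) : Prop where
  pos : 0 < n
  two_lt : 2 < B
  two_dvd : 2 ∣ B
  sq_lt : n * n < B
  cube_le : n * n * n ≤ B
  sq_dvd : n * n ∣ B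

section
variable {n b B : ℕ} {W : ℕ → ℕ}

theorem Roomy.lt (hB : Roomy n B) : n < B :=
  (Nat.le_mul_of_pos_left n hB.pos).trans_lt hB.sq_lt

theorem mul_add_lt_sq {k : ℕ} (hb : b ≤ n) (hb' : 0 < b) (hk : k < n) :
    (b - 1) * n + k < n * n := by
  calc (b - 1) * n + k < (b - 1) * n + n := by omega
    _ = (b - 1 + 1) * n := by ring
    _ ≤ n * n := Nat.mul_le_mul_right n (by omega)

theorem Roomy.left_lt (hB : Roomy n B) {y r : ℕ} (hy : y < B) (hr : r < n * n) :
    y / (n * n) * (n * n) + r < B := by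
  obtain ⟨q, hq⟩ := hB.sq_dvd
  have h1 : y / (n * n) < q := by
    rw [Nat.div_lt_iff_lt_mul (Nat.mul_pos hB.pos hB.pos), Nat.mul_comm, ← hq]
    exact hy
  calc y / (n * n) * (n * n) + r < y / (n * n) * (n * n) + n * n := by omega
    _ = (y / (n * n) + 1) * (n * n) := by ring
    _ ≤ q * (n * n) := Nat.mul_le_mul_right _ h1
    _ = B := by rw [hq, Nat.mul_comm]

theorem Roomy.right_lt (hB : Roomy n B) {y i : ℕ} (hi : i < n) : y % (n * n) * n + i < B := by
  have h1 : y % (n * n) < n * n := Nat.mod_lt _ (Nat.mul_pos hB.pos hB.pos)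
  calc y % (n * n) * n + i < y % (n * n) * n + n := by omega
    _ = (y % (n * n) + 1) * n := by ring
    _ ≤ n * n * n := Nat.mul_le_mul_right _ h1
    _ ≤ B := hB.cube_le

theorem update_lt {a x : ℕ} (hW : ∀ a, W a < B) (hx : x < B) :
    ∀ c, Function.update W a x c < B := by
  intro c
  rw [Function.update_apply]
  split_ifs
  · exact hx
  · exact hW c

theorem put_lt (hB : Roomy n B) (hW : ∀ a, W a < B) (hb : b ≤ n) {l x : ℕ} (hx : x < B) :
    ∀ a, put n b W l x a < B := by
  unfold put
  split_ifs with h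
  · refine update_lt (update_lt hW hx) ?_
    have := mul_add_lt_sq hb (by omega) (Nat.mod_lt x hB.pos)
    have := hB.sq_lt
    omega
  · exact update_lt hW hx

theorem chain_lt (hB : Roomy n B) (hW : ∀ a, W a < B) (hb : b ≤ n) {i f y : ℕ} (hi : i < b)
    (hf : f < n) (hy : y < B) : ∀ a, chain n b W i f y a < B :=
  update_lt (update_lt hW (hB.left_lt hy (mul_add_lt_sq hb (by omega) hf))) (hB.right_lt (by omega))

theorem shrink_lt (hB : Roomy n B) (hW : ∀ a, W a < B) :
    ∀ a, shrink n b W a < B := by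
  unfold shrink
  split_ifs
  · refine update_lt hW ?_
    have := hW n
    obtain ⟨q, hq⟩ := hB.two_dvd
    omega
  · exact update_lt hW (by have := hW 0; omega)

end

/-! ### The programs -/

/-- The remainder of `a` modulo `c`. -/
def modE (a c : Expr) : Expr := .sub a (.mul (.div a c) c)

/-- The universe size, kept in variable `4`. -/
abbrev nE : Expr := .var 4

/-- The size of the left area, kept in variable `5`. -/
abbrev bE : Expr := .var 5

/-- The square of the universe size. -/
abbrev sqE : Expr := .mul nE nE

/-- Set variable `5` to the size of the left area. -/
def leftSizeS : Stmt :=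
  .ifEq (modE (.load nE) (.lit 2)) (.lit 1) (.set 5 (.lit 0))
    (.set 5 (.add (modE (.div (.load (.lit 0)) nE) nE) (.lit 1)))

/-- Set `j` to the index to which word `v` points, `c` to `1` if `v` is paired and to `0`
otherwise, and `z` to the value at index `v`. -/
def fetchS (v j c z : Fin 16) : Stmt :=
  .set j (modE (.load (.var v)) nE) ;;
  .ifLt (.var v) bE
    (.ifEq (modE (.load (.var j)) nE) (.var v)
      (.ifLt (.var j) bE (.set c (.lit 0) ;; .set z (.lit 0))
        (.set c (.lit 1) ;; .set z (.add (.mul (.div (.load (.var v)) sqE) sqE)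
          (.div (.load (.var j)) nE))))
      (.set c (.lit 0) ;; .set z (.lit 0)))
    (.ifEq (modE (.load (.var j)) nE) (.var v)
      (.ifLt (.var j) bE (.set c (.lit 1) ;; .set z (.lit 0))
        (.set c (.lit 0) ;; .set z (.load (.var v))))
      (.set c (.lit 0) ;; .set z (.load (.var v))))

/-- Perform `put`. -/
def putS (l x : Fin 16) : Stmt :=
  .store (.var l) (.var x) ;;
  .set 15 (modE (.var x) nE) ;;
  .ifLt (.var 15) bE
    (.ifEq (modE (.load (.var 15)) nE) (.var l)
      (.store (.var 15) (.add (.mul (.sub bE (.lit 1)) nE) (.var 15))) .skip)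
    .skip

/-- Perform `chain`. -/
def chainS (i f y : Fin 16) : Stmt :=
  .store (.var i) (.add (.mul (.div (.var y) sqE) sqE)
    (.add (.mul (.sub bE (.lit 1)) nE) (.var f))) ;;
  .store (.var f) (.add (.mul (modE (.var y) sqE) nE) (.var i))

/-- Perform `shrink`. -/
def shrinkS : Stmt :=
  .ifEq bE (.lit 0)
    (.store nE (.add (.sub (.load nE) (modE (.load nE) (.lit 2))) (.lit 1)))
    (.store (.lit 0) (.sub (.load (.lit 0)) nE))

/-- Perform `grow`. -/
def growS : Stmt :=
  .set 9 (.sub bE (.lit 1)) ;;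
  fetchS 9 10 11 12 ;;
  .set 5 (.var 9) ;;
  .ifEq (.var 11) (.lit 1) .skip (.set 10 (.var 9)) ;;
  shrinkS ;;
  putS 9 12 ;;
  .ifEq (.var 10) (.var 2) .skip (chainS 13 10 14) ;;
  .ifLt (.var 2) bE .skip (putS 2 3)

/-- The reading procedure. -/
def readS : Stmt := leftSizeS ;; fetchS 2 6 7 8 ;; .set 0 (.var 8)

/-- The writing procedure. -/
def writeS : Stmt :=
  leftSizeS ;;
  fetchS 2 6 7 8 ;;
  .ifLt (.var 2) bE
    (.ifEq (.var 7) (.lit 1) (chainS 2 6 3)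
      (.set 13 (.var 2) ;; .set 14 (.var 3) ;; growS))
    (.ifEq (.var 7) (.lit 1)
      (fetchS 6 15 0 14 ;; .set 13 (.var 6) ;; growS)
      (putS 2 3))

/-- The initialization procedure. -/
def initS : Stmt :=
  .set 4 (.var 0) ;;
  .store nE (.sub (.load nE) (modE (.load nE) (.lit 2))) ;;
  .store (.lit 0) (.mul (.sub nE (.lit 1)) nE)

/-! ### Weakest preconditions of the building blocks -/

section
variable {n B : ℕ} {E : Fin 16 → ℕ} {W : ℕ → ℕ} {Q : (Fin 16 → ℕ) → (ℕ → ℕ) → Prop}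

@[simp] theorem val_modE (a c : Expr) : (modE a c).val E W = a.val E W % c.val E W := by
  simp only [modE, Expr.val]
  rw [Nat.mod_eq_sub_div_mul]

theorem ok_modE {a c : Expr} (ha : a.Ok B n E W) (hc : c.Ok B n E W) (hlt : a.val E W < B)
    (hpos : 0 < c.val E W) : (modE a c).Ok B n E W :=
  have h := Nat.div_mul_le_self (a.val E W) (c.val E W)
  ⟨ha, ⟨⟨ha, hc, hpos⟩, hc, h.trans_lt hlt⟩, h⟩

theorem wp_leftSizeS (hB : Roomy n B) (hW : ∀ a, W a < B) (h4 : E 4 = n)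
    (h : Q (Function.update E 5 (leftSize n W)) W) : leftSizeS.wp B n Q E W := by
  have h2 := hB.two_lt
  have hn := hB.pos
  refine ⟨ok_modE ⟨trivial, ?_⟩ h2 (hW _) (by simp [Expr.val]), ?_, fun hc => ⟨?_, ?_⟩,
    fun hc => ⟨⟨ok_modE ⟨⟨?_, ?_⟩, trivial, ?_⟩ trivial ?_ ?_, ?_, ?_⟩, ?_⟩⟩
  · simp [Expr.val, h4]
  · exact (by omega : 1 < B)
  · exact (by omega : 0 < B)
  · simp only [val_modE, Expr.val, h4] at hc
    simpa [Expr.val, leftSize, hc] using h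
  · exact (by omega : 0 < B)
  · simp [Expr.val]
  · simpa [Expr.val, h4] using hn
  · exact (Nat.div_le_self _ _).trans_lt (hW _)
  · simpa [Expr.val, h4] using hn
  · exact (by omega : 1 < B)
  · simp only [val_modE, Expr.val, h4]
    have := Nat.mod_lt (W 0 / n) hn
    have := hB.lt
    omega
  · simp only [val_modE, Expr.val, h4] at hc
    simpa [Expr.val, leftSize, hc, h4] using h

/-- In an arbitrary memory the two parts of a paired value may sum to more than a word holds. The
bound `hdec` excludes this and is available whenever the memory represents a sequence of words. -/
theorem wp_fetchS (hB : Roomy n B) (hW : ∀ a, W a < B) {v j c z : Fin 16}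
    (hd : v ≠ j ∧ v ≠ c ∧ j ≠ c ∧ j ≠ 4 ∧ j ≠ 5 ∧ c ≠ 4 ∧ c ≠ 5) (h4 : E 4 = n) (hv : E v < n)
    (hdec : decode n (E 5) W (E v) < B)
    (h : Q (Function.update (Function.update (Function.update E j (W (E v) % n)) c
      (if Paired n (E 5) W (E v) (W (E v) % n) ∨ Paired n (E 5) W (W (E v) % n) (E v) then 1
        else 0)) z (decode n (E 5) W (E v))) W) : (fetchS v j c z).wp B n Q E W := by
  obtain ⟨d1, d2, d3, d4, d5, d6, d7⟩ := hd
  have h2 := hB.two_lt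
  have hn := hB.pos
  have hj := Nat.mod_lt (W (E v)) hn
  have hsq := Nat.mul_pos hn hn
  have hsq' := hB.sq_lt
  have hbig : W (E v) / (n * n) * (n * n) < B :=
    (Nat.div_mul_le_self _ _).trans_lt (hW _)
  have hmod : ∀ {a : Expr} {E' : Fin 16 → ℕ}, E' 4 = n → a.val E' W ≤ n → a.Ok B n E' W →
      (modE (.load a) nE).Ok B n E' W := fun he ha hok =>
    ok_modE ⟨hok, ha⟩ trivial (hW _) (by simpa [Expr.val, he] using hn)
  refine ⟨hmod h4 hv.le trivial, ?_⟩
  have e4 : Function.update E j (W (E v) % n) 4 = n := by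
    rw [Function.update_of_ne d4.symm, h4]
  simp only [Stmt.wp, val_modE, Expr.val, h4]
  have ok1 : (modE (.load (.var j)) nE).Ok B n (Function.update E j (W (E v) % n)) W :=
    hmod e4 (by simpa [Expr.val] using hj.le) trivial
  simp only [Expr.Ok, ok1, Expr.val, Function.update_self, Function.update_of_ne d1,
    Function.update_of_ne d4.symm, Function.update_of_ne d5.symm, Function.update_of_ne d3,
    Function.update_of_ne d2, Function.update_of_ne d6.symm, h4, true_and]
  by_cases hl : E v < E 5
  · by_cases hm : W (W (E v) % n) % n = E v
    · by_cases hjb : W (E v) % n < E 5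
      · have c1 : ¬ (Paired n (E 5) W (E v) (W (E v) % n) ∨
          Paired n (E 5) W (W (E v) % n) (E v)) := by unfold Paired; omega
        have c2 : decode n (E 5) W (E v) = 0 := by
          rw [decode, if_pos hl, if_neg fun h => c1 (Or.inl h)]
        rw [if_neg c1, c2] at h
        simp only [hl, hm, hjb, true_implies, not_true_eq_false, false_implies, ne_eq, and_true]
        and_intros <;> first | exact h | exact hbig | omega
      · have c1 : Paired n (E 5) W (E v) (W (E v) % n) := by unfold Paired; omega
        have c2 := decode_of_paired_left c1
        rw [if_pos (Or.inl c1)] at h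
        rw [c2] at h hdec
        simp only [hl, hm, hjb, true_implies, not_true_eq_false, false_implies, ne_eq, and_true,
          true_and, not_false_eq_true]
        and_intros <;> first | exact h | exact hbig | omega
    · have c1 : ¬ (Paired n (E 5) W (E v) (W (E v) % n) ∨
          Paired n (E 5) W (W (E v) % n) (E v)) := by unfold Paired; omega
      have c2 : decode n (E 5) W (E v) = 0 := by
        rw [decode, if_pos hl, if_neg fun h => c1 (Or.inl h)]
      rw [if_neg c1, c2] at h
      simp only [hl, hm, true_implies, not_true_eq_false, false_implies, ne_eq, and_true, true_and,
        not_false_eq_true]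
      and_intros <;> first | exact h | exact hbig | omega
  · by_cases hm : W (W (E v) % n) % n = E v
    · by_cases hjb : W (E v) % n < E 5
      · have c1 : Paired n (E 5) W (W (E v) % n) (E v) := by unfold Paired; omega
        have c2 := decode_of_paired_right c1
        rw [if_pos (Or.inr c1), c2] at h
        simp only [hl, hm, hjb, true_implies, not_true_eq_false, false_implies, ne_eq, and_true,
          true_and, not_false_eq_true]
        and_intros <;> first | exact h | exact hbig | omega
      · have c1 : ¬ (Paired n (E 5) W (E v) (W (E v) % n) ∨
          Paired n (E 5) W (W (E v) % n) (E v)) := by unfold Paired; omega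
        have c2 : decode n (E 5) W (E v) = W (E v) := by
          rw [decode, if_neg hl, if_neg fun h => c1 (Or.inr h)]
        rw [if_neg c1, c2] at h
        simp only [hl, hm, hjb, true_implies, not_true_eq_false, false_implies, ne_eq, and_true,
          true_and, not_false_eq_true]
        and_intros <;> first | exact h | exact hbig | omega
    · have c1 : ¬ (Paired n (E 5) W (E v) (W (E v) % n) ∨
          Paired n (E 5) W (W (E v) % n) (E v)) := by unfold Paired; omega
      have c2 : decode n (E 5) W (E v) = W (E v) := by
        rw [decode, if_neg hl, if_neg fun h => c1 (Or.inr h)]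
      rw [if_neg c1, c2] at h
      simp only [hl, hm, true_implies, false_implies, ne_eq, true_and, not_false_eq_true]
      and_intros <;> first | exact h | omega

theorem wp_putS (hB : Roomy n B) (hW : ∀ a, W a < B) {l x : Fin 16} (hl : l ≠ 15) (h4 : E 4 = n)
    (hlb : E 5 ≤ E l) (hln : E l < n) (hx : E x < B)
    (h : Q (Function.update E 15 (E x % n)) (put n (E 5) W (E l) (E x))) :
    (putS l x).wp B n Q E W := by
  have h2 := hB.two_lt
  have hn := hB.pos
  have hsq' := hB.sq_lt
  have hk := Nat.mod_lt (E x) hn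
  refine ⟨trivial, trivial, hln.le, ok_modE trivial trivial hx (by simpa [Expr.val, h4] using hn),
    trivial, trivial, fun hc => ?_, fun hc => ?_⟩
  · simp [Expr.val, h4] at hc
    refine ⟨ok_modE ⟨trivial, ?_⟩ trivial (update_lt hW hx _) ?_, trivial, fun hm => ?_,
      fun hm => ?_⟩
    · simpa [Expr.val, h4] using hk.le
    · simpa [Expr.val, h4] using hn
    · have hlt := mul_add_lt_sq (n := n) (b := E 5) (by omega) (by omega) hk
      have hne : E x % n ≠ E l := by omega
      simp [Expr.val, h4, hl, hne] at hm
      simp only [put, hc, hm, and_self, if_true] at h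
      simp only [Stmt.wp, Expr.Ok, Expr.val, val_modE, h4]
      simp [h4, h]
      omega
    · have hne : E x % n ≠ E l := by omega
      simp [Expr.val, h4, hl, hne] at hm
      simp only [put, hm, and_false, if_false] at h
      simpa [Stmt.wp, Expr.val, h4] using h
  · simp [Expr.val, h4] at hc
    simp only [put, hc.not_gt, false_and, if_false] at h
    simpa [Stmt.wp, Expr.val, h4] using h

theorem wp_chainS (hB : Roomy n B) {i f y : Fin 16} (h4 : E 4 = n)
    (hi : E i < E 5) (hb : E 5 ≤ n) (hf : E f < n) (hy : E y < B)
    (h : Q E (chain n (E 5) W (E i) (E f) (E y))) : (chainS i f y).wp B n Q E W := by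
  have h2 := hB.two_lt
  have hn := hB.pos
  have hsq' := hB.sq_lt
  have hsq := Nat.mul_pos hn hn
  have hlt := mul_add_lt_sq hb (by omega) hf
  have h1 := hB.left_lt hy hlt
  have h3 := hB.right_lt (y := E y) (i := E i) (by omega)
  have hmod : ∀ W', (modE (.var y) sqE).Ok B n E W' := fun W' =>
    ok_modE trivial ⟨trivial, trivial, by simpa [Expr.val, h4] using hsq'⟩ hy
      (by simpa [Expr.val, h4] using hsq)
  simp only [chainS, Stmt.wp, Expr.Ok, Expr.val, val_modE, h4, hmod, true_and]
  and_intros <;> first | exact h | omega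

theorem wp_shrinkS (hB : Roomy n B) (hW : ∀ a, W a < B) (h4 : E 4 = n)
    (hb : leftSize n W = E 5 + 1) (h : Q E (shrink n (E 5) W)) : shrinkS.wp B n Q E W := by
  have h2 := hB.two_lt
  have hn := hB.pos
  have hWn := hW n
  have hpar : W n - W n % 2 + 1 < B := by
    obtain ⟨q, hq⟩ := hB.two_dvd
    omega
  have hmod : (modE (.load nE) (.lit 2)).Ok B n E W :=
    ok_modE ⟨trivial, by simp [Expr.val, h4]⟩ h2 (hW _) (by simp [Expr.val])
  simp only [shrinkS, Stmt.wp, Expr.Ok, Expr.val, val_modE, h4, hmod, true_and]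
  refine ⟨by omega, fun hc => ⟨?_, le_rfl, ?_⟩, fun hc => ⟨by omega, ?_, by omega, ?_⟩⟩
  · have := Nat.mod_le (W n) 2
    omega
  · simpa [shrink, hc] using h
  · exact ⟨by omega, le_of_leftSize hb hc⟩
  · simpa [shrink, hc] using h

theorem wp_growS {b : ℕ} (hB : Roomy n B) (hW : ∀ a, W a < B) (h4 : E 4 = n) (h5 : E 5 = b + 1)
    (hb : leftSize n W = b + 1) (hl : E 2 < n) (hx : E 3 < B) (hy : E 14 < B)
    (hdec : decode n (b + 1) W b < B) (hib : freed n b W ≠ E 2 → E 13 < b)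
    (h : ∀ E', Q E' (grow n b W (shrink n b W) (E 2) (E 3) (E 13) (E 14))) :
    growS.wp B n Q E W := by
  have h2 := hB.two_lt
  have hn := hB.pos
  have hbn : b + 1 ≤ n := hb ▸ leftSize_le hn
  have hW1 := shrink_lt (b := b) hB hW
  have hfr : freed n b W < n := freed_lt hbn
  refine ⟨⟨trivial, (by omega : 1 < B), ?_⟩, ?_⟩
  · simp only [Expr.val]; omega
  have e9 : Function.update E 9 (Expr.val E W (bE.sub (.lit 1))) = Function.update E 9 b := by
    simp [Expr.val, h5]
  rw [e9]
  refine wp_fetchS hB hW (by decide) (by simpa using h4) (by simp; omega)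
    (by simpa [h5] using hdec) ?_
  refine ⟨trivial, ?_⟩
  simp only [Expr.val, Function.update_self, Function.update_of_ne (by decide : (5 : Fin 16) ≠ 9),
    h5]
  -- From here on only these variables matter; in particular variable `10` holds the freed index,
  -- whether or not the last left word was paired.
  have hfe : ∀ Q' : (Fin 16 → ℕ) → (ℕ → ℕ) → Prop,
      (∀ E' : Fin 16 → ℕ, E' 2 = E 2 → E' 3 = E 3 → E' 4 = n → E' 5 = b → E' 9 = b →
        E' 10 = freed n b W → E' 12 = decode n (b + 1) W b → E' 13 = E 13 → E' 14 = E 14 →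
        Q' E' W) →
      (Stmt.ifEq (.var 11) (.lit 1) .skip (.set 10 (.var 9))).wp B n Q'
        (Function.update (Function.update (Function.update (Function.update (Function.update E 9 b)
          10 (W b % n)) 11 (if Paired n (b + 1) W b (W b % n) ∨ Paired n (b + 1) W (W b % n) b
            then 1 else 0)) 12 (decode n (b + 1) W b)) 5 b) W := by
    intro Q' hQ
    have hnp : ¬ Paired n (b + 1) W (W b % n) b := fun h => by have := h.2.1; omega
    refine ⟨trivial, (by omega : 1 < B), fun hc => ?_, fun hc => ⟨trivial, ?_⟩⟩
    · have hp : Paired n (b + 1) W b (W b % n) := by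
        by_contra hp
        simp [Expr.val, hp, hnp] at hc
      refine hQ _ ?_ ?_ ?_ ?_ ?_ ?_ ?_ ?_ ?_ <;> simp [h4, freed, hp]
    · have hp : ¬ Paired n (b + 1) W b (W b % n) := by
        intro hp
        simp [Expr.val, hp] at hc
      refine hQ _ ?_ ?_ ?_ ?_ ?_ ?_ ?_ ?_ ?_ <;> simp [Expr.val, h4, freed, hp]
  refine hfe _ fun E' f2 f3 f4 f5 f9 f10 f12 f13 f14 => ?_
  refine wp_shrinkS hB hW f4 (by rw [f5, hb]) ?_
  rw [f5]
  refine wp_putS hB hW1 (by decide) f4 (by omega) (by omega) (by omega) ?_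
  rw [f5, f9, f12]
  have hW2 := put_lt hB hW1 (b := b) (by omega) hdec (l := b)
  generalize hE : Function.update E' 15 _ = E''
  have hEE : ∀ u, u ≠ 15 → E'' u = E' u := fun u hu => by
    rw [← hE, Function.update_of_ne hu]
  have g2 := (hEE 2 (by decide)).trans f2
  have g3 := (hEE 3 (by decide)).trans f3
  have g4 := (hEE 4 (by decide)).trans f4
  have g5 := (hEE 5 (by decide)).trans f5
  have g10 := (hEE 10 (by decide)).trans f10
  have g13 := (hEE 13 (by decide)).trans f13
  have g14 := (hEE 14 (by decide)).trans f14
  -- The final conditional store is common to the cases with and without a new pair.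
  have last : ∀ W' : ℕ → ℕ, (∀ a, W' a < B) →
      (∀ E''', Q E''' (if E 2 < b then W' else put n b W' (E 2) (E 3))) →
      (Stmt.ifLt (.var 2) bE .skip (putS 2 3)).wp B n Q E'' W' := by
    intro W' hW' hQ
    refine ⟨trivial, trivial, fun hc => ?_, fun hc => ?_⟩
    · simp only [Expr.val, g2, g5] at hc
      simpa [Stmt.wp, hc] using hQ E''
    · simp only [Expr.val, g2, g5] at hc
      refine wp_putS hB hW' (by decide) g4 (by omega) (by omega) (by omega) ?_
      rw [g5, g2, g3]
      simpa [hc] using hQ _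
  refine ⟨trivial, trivial, fun hc => ?_, fun hc => ?_⟩
  · simp only [Expr.val, g10, g2] at hc
    refine last _ hW2 fun E''' => ?_
    simpa [grow, hc] using h E'''
  · simp only [Expr.val, g10, g2] at hc
    refine wp_chainS hB g4 (by have := hib hc; omega) (by omega) (by omega) (by omega) ?_
    rw [g5, g13, g10, g14]
    refine last _ (chain_lt hB hW2 (by omega) (hib hc) hfr hy) fun E''' => ?_
    simpa [grow, hc] using h E'''

end

/-! ### Correctness of reading, writing and initialization -/

section
variable {n B b : ℕ} {E : Fin 16 → ℕ} {W : ℕ → ℕ} {Q : (Fin 16 → ℕ) → (ℕ → ℕ) → Prop}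

theorem put_apply_universe {l x : ℕ} (hb : b ≤ n) (hl : l < n) : put n b W l x n = W n :=
  put_apply_of_ne (by omega) (by omega)

theorem chain_apply_universe {i f y : ℕ} (hi : i < n) (hf : f < n) :
    chain n b W i f y n = W n := by
  unfold chain
  rw [Function.update_of_ne (by omega), Function.update_of_ne (by omega)]

/-- Word `n` may contain foreign bits. Preserving its quotient by `2` means touching only the flag.
-/
theorem shrink_apply_universe (hn : 0 < n) : shrink n b W n / 2 = W n / 2 := by
  unfold shrink
  split_ifs
  · rw [Function.update_self]
    omega
  · rw [Function.update_of_ne (by omega)]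

theorem leftSize_grow (hn : 0 < n) {W₁ : ℕ → ℕ} {l x i y : ℕ} (hb : leftSize n W₁ = b)
    (hbn : b < n) (hl : l < n) (hi : freed n b W ≠ l → i < b) :
    leftSize n (grow n b W W₁ l x i y) = b := by
  have h2 := leftSize_put (x := decode n (b + 1) W b) hn hb le_rfl hbn
  have h3 : leftSize n (if freed n b W = l then put n b W₁ b (decode n (b + 1) W b)
      else chain n b (put n b W₁ b (decode n (b + 1) W b)) i (freed n b W) y) = b := by
    split_ifs with h
    · exact h2
    · exact leftSize_chain hn h2 (hi h) le_freed (freed_lt hbn)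
  unfold grow
  simp only
  by_cases h : l < b
  · rw [if_pos h, h3]
  · rw [if_neg h, leftSize_put hn h3 (by omega) hl]

theorem grow_apply_universe {W₁ : ℕ → ℕ} {l x i y : ℕ} (hbn : b < n) (hl : l < n) (hi : i < n) :
    grow n b W W₁ l x i y n = W₁ n := by
  unfold grow
  split_ifs <;>
    simp only [put_apply_universe hbn.le hl, put_apply_universe hbn.le hbn,
      chain_apply_universe hi (freed_lt hbn)]

/-- `W'` represents the sequence that results from that represented by `W` by replacing the value
at index `l` by `x`, and differs from `W` in word `n` at most in the least significant bit. -/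
def Writes (n : ℕ) (W : ℕ → ℕ) (l x : ℕ) (W' : ℕ → ℕ) : Prop :=
  W' n / 2 = W n / 2 ∧ ∀ a < n, decode n (leftSize n W') W' a =
    if a = l then x else decode n (leftSize n W) W a

theorem writes_grow_left (hn : 0 < n) {l x : ℕ} (hb : leftSize n W = b + 1) (hl : l < b + 1)
    (hlp : ∀ j, ¬ Paired n (b + 1) W l j) :
    Writes n W l x (grow n b W (shrink n b W) l x l x) := by
  have hbn : b + 1 ≤ n := hb ▸ leftSize_le hn
  have hi : freed n b W ≠ l → l < b := fun h => by
    refine lt_of_le_of_ne (by omega) ?_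
    rintro rfl
    exact h (freed_of_not_paired hlp)
  refine ⟨?_, fun a ha => ?_⟩
  · rw [grow_apply_universe hbn (by omega) (by omega), shrink_apply_universe hn]
  · rw [leftSize_grow hn (leftSize_shrink hn hb) hbn (by omega) hi, hb]
    exact decode_grow_left hn hbn (sameUpToDigit_shrink hn hb) ha hl hlp

theorem writes_grow_right (hn : 0 < n) {l x i : ℕ} (hb : leftSize n W = b + 1)
    (hil : Paired n (b + 1) W i l) :
    Writes n W l x (grow n b W (shrink n b W) l x i (decode n (b + 1) W i)) := by
  have hbn : b + 1 ≤ n := hb ▸ leftSize_le hn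
  have hi : freed n b W ≠ l → i < b := fun h => by
    refine lt_of_le_of_ne (by have := hil.1; omega) ?_
    rintro rfl
    exact h (freed_of_paired hil)
  have hlt := hil.lt hn
  refine ⟨?_, fun a ha => ?_⟩
  · rw [grow_apply_universe hbn hlt.2 hlt.1, shrink_apply_universe hn]
  · rw [leftSize_grow hn (leftSize_shrink hn hb) hbn hlt.2 hi, hb]
    exact decode_grow_right hn hbn (sameUpToDigit_shrink hn hb) ha hil

theorem writes_chain (hn : 0 < n) {i j x : ℕ} (h : Paired n (leftSize n W) W i j) :
    Writes n W i x (chain n (leftSize n W) W i j x) := by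
  have hlt := h.lt hn
  refine ⟨by rw [chain_apply_universe hlt.1 hlt.2], fun a _ => ?_⟩
  rw [leftSize_chain hn rfl h.1 h.2.1 hlt.2, decode_chain_of_paired hn h (leftSize_le hn)]

theorem writes_put (hn : 0 < n) {l x : ℕ} (hl : leftSize n W ≤ l) (hln : l < n)
    (h : ∀ i, ¬ Paired n (leftSize n W) W i l) :
    Writes n W l x (put n (leftSize n W) W l x) := by
  refine ⟨by rw [put_apply_universe (leftSize_le hn) hln], fun a _ => ?_⟩
  rw [leftSize_put hn rfl hl hln, decode_put_of_not_paired hl h]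

theorem wp_readS (hB : Roomy n B) (hW : ∀ a, W a < B) (h4 : E 4 = n) (hl : E 2 < n)
    (hdec : ∀ a < n, decode n (leftSize n W) W a < B)
    (h : ∀ E', E' 0 = decode n (leftSize n W) W (E 2) → Q E' W) : readS.wp B n Q E W := by
  refine wp_leftSizeS hB hW h4 (wp_fetchS hB hW (by decide) (by simpa using h4) (by simpa using hl)
    (by simpa using hdec _ hl) ⟨trivial, h _ ?_⟩)
  simp [Expr.val]

theorem wp_writeS (hB : Roomy n B) (hW : ∀ a, W a < B) (h4 : E 4 = n) (hl : E 2 < n)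
    (hx : E 3 < B) (hdec : ∀ a < n, decode n (leftSize n W) W a < B)
    (h : ∀ E' W', Writes n W (E 2) (E 3) W' → Q E' W') : writeS.wp B n Q E W := by
  have hn := hB.pos
  have h2 := hB.two_lt
  have hbn := leftSize_le (W := W) hn
  have hmod := Nat.mod_lt (W (E 2)) hn
  refine wp_leftSizeS hB hW h4 (wp_fetchS hB hW (by decide) (by simpa using h4) (by simpa using hl)
    (by simpa using hdec _ hl) ?_)
  simp only [Function.update_self, Function.update_of_ne (by decide : (2 : Fin 16) ≠ 5)]
  generalize hc : (if Paired n (leftSize n W) W (E 2) (W (E 2) % n) ∨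
    Paired n (leftSize n W) W (W (E 2) % n) (E 2) then 1 else 0) = c
  generalize hE : Function.update (Function.update (Function.update (Function.update E 5
    (leftSize n W)) 6 (W (E 2) % n)) 7 c) 8 (decode n (leftSize n W) W (E 2)) = E'
  have g2 : E' 2 = E 2 := by simp [← hE]
  have g3 : E' 3 = E 3 := by simp [← hE]
  have g4 : E' 4 = n := by simpa [← hE] using h4
  have g5 : E' 5 = leftSize n W := by simp [← hE]
  have g6 : E' 6 = W (E 2) % n := by simp [← hE]
  have g7 : E' 7 = c := by simp [← hE]
  refine ⟨trivial, trivial, fun hlb => ⟨trivial, (by omega : 1 < B), fun hc1 => ?_, fun hc0 => ?_⟩,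
    fun hlb => ⟨trivial, (by omega : 1 < B), fun hc1 => ?_, fun hc0 => ?_⟩⟩
  · simp only [Expr.val, g2, g5, g7] at hlb hc1
    have hp : Paired n (leftSize n W) W (E 2) (W (E 2) % n) := by
      by_contra hp
      have hp' : ¬ Paired n (leftSize n W) W (W (E 2) % n) (E 2) := fun h => by
        have := h.2.1
        omega
      simp only [hp, hp', or_self, if_false] at hc
      omega
    refine wp_chainS hB g4 (by omega) (by omega) (by omega) (by omega) (h _ _ ?_)
    rw [g5, g2, g6, g3]
    exact writes_chain hn hp
  · simp only [Expr.val, g2, g5, g7] at hlb hc0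
    obtain ⟨b, hb⟩ : ∃ b, leftSize n W = b + 1 := ⟨leftSize n W - 1, by omega⟩
    rw [hb] at hc hlb hdec g5
    have hlp : ∀ j, ¬ Paired n (b + 1) W (E 2) j := by
      intro j hj
      have hj' := hj.2.2.1
      rw [← hj'] at hj
      simp only [hj, true_or, if_true] at hc
      omega
    refine ⟨trivial, trivial, ?_⟩
    refine wp_growS hB hW (by simpa [Expr.val] using g4) (b := b) (by simpa [Expr.val] using g5) hb
      (by simpa [Expr.val, g2] using hl) (by simpa [Expr.val, g3] using hx)
      (by simpa [Expr.val, g3] using hx) (hdec b (by omega)) ?_ fun E'' => h _ _ ?_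
    · simp only [Expr.val, g2, ne_eq, Fin.reduceEq, not_false_eq_true, Function.update_of_ne,
        Function.update_self]
      intro hf
      refine lt_of_le_of_ne (by omega) ?_
      rintro rfl
      exact hf (freed_of_not_paired hlp)
    · simp only [Expr.val, g2, g3, ne_eq, Fin.reduceEq, not_false_eq_true, Function.update_of_ne,
        Function.update_self]
      exact writes_grow_left hn hb hlb hlp
  · simp only [Expr.val, g2, g5, g7] at hlb hc1
    have hp : Paired n (leftSize n W) W (W (E 2) % n) (E 2) := by
      by_contra hp
      have hp' : ¬ Paired n (leftSize n W) W (E 2) (W (E 2) % n) := fun h => by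
        have := h.1
        omega
      simp only [hp, hp', or_self, if_false] at hc
      omega
    obtain ⟨b, hb⟩ : ∃ b, leftSize n W = b + 1 := ⟨leftSize n W - 1, by have := hp.1; omega⟩
    refine wp_fetchS hB hW (by decide) g4 (by omega) (by rw [g5, g6]; exact hdec _ hmod) ?_
    rw [g5, g6]
    rw [hb] at hlb hdec g5 hp ⊢
    refine ⟨trivial, ?_⟩
    refine wp_growS hB hW (by simpa [Expr.val] using g4) (b := b) (by simpa [Expr.val] using g5) hb
      (by simpa [Expr.val, g2] using hl) (by simpa [Expr.val, g3] using hx) ?_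
      (hdec b (by omega)) ?_ fun E'' => h _ _ ?_
    · simpa using hdec _ hmod
    · simp only [Expr.val, g2, g6, ne_eq, Fin.reduceEq, not_false_eq_true, Function.update_of_ne,
        Function.update_self]
      intro hf
      refine lt_of_le_of_ne (by have := hp.1; omega) fun he => hf ?_
      rw [he] at hp
      exact freed_of_paired hp
    · simp only [Expr.val, g2, g3, g6, ne_eq, Fin.reduceEq, not_false_eq_true,
        Function.update_of_ne, Function.update_self]
      exact writes_grow_right hn hb hp
  · simp only [Expr.val, g2, g5, g7] at hlb hc0
    have hlp : ∀ i, ¬ Paired n (leftSize n W) W i (E 2) := by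
      intro i hi
      have hi' := hi.2.2.2
      rw [← hi'] at hi
      simp only [hi, or_true, if_true] at hc
      omega
    refine wp_putS hB hW (by decide) g4 (by omega) (by omega) (by omega) (h _ _ ?_)
    rw [g5, g2, g3]
    exact writes_put hn (by omega) hl hlp

/-- The initialized memory. -/
def initial (n : ℕ) (W : ℕ → ℕ) : ℕ → ℕ :=
  Function.update (Function.update W n (W n - W n % 2)) 0 ((n - 1) * n)

theorem leftSize_initial (hn : 0 < n) : leftSize n (initial n W) = n := by
  unfold leftSize initial
  rw [Function.update_of_ne (by omega), Function.update_self, Function.update_self,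
    if_neg (by omega), Nat.mul_div_cancel _ hn, Nat.mod_eq_of_lt (by omega)]
  omega

theorem decode_initial (hn : 0 < n) {l : ℕ} (hl : l < n) :
    decode n (leftSize n (initial n W)) (initial n W) l = 0 := by
  rw [leftSize_initial hn]
  refine decode_left_of_not_paired hl fun j hj => ?_
  have := hj.2.1
  have := (hj.lt hn).2
  omega

theorem wp_initS (hB : Roomy n B) (hW : ∀ a, W a < B) (h0 : E 0 = n)
    (h : ∀ E', Q E' (initial n W)) : initS.wp B n Q E W := by
  have hn := hB.pos
  have h2 := hB.two_lt
  have hsq := hB.sq_lt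
  have hmod : (modE (.load nE) (.lit 2)).Ok B n (Function.update E 4 n) W :=
    ok_modE ⟨trivial, by simp [Expr.val]⟩ h2 (hW _) (by simp [Expr.val])
  have h1 := Nat.mod_le (W n) 2
  have h3 : (n - 1) * n ≤ n * n := Nat.mul_le_mul_right n (by omega)
  simp only [initS, Stmt.wp, Expr.Ok, Expr.val, val_modE, h0, Function.update_self, hmod, true_and]
  and_intros <;> first | exact h _ | omega

/-- Pointers are reduced modulo `n`, so even garbage leads only to words below `n`. This confines
the representation to the occupied bits. -/
theorem decode_ext (hn : 0 < n) {W' : ℕ → ℕ} (h : ∀ a < n, W a = W' a) {l : ℕ} (hl : l < n) :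
    decode n b W l = decode n b W' l := by
  have h1 := h l hl
  have h2 := h _ (Nat.mod_lt (W' l) hn)
  simp only [decode, Paired, h1, h2]

theorem leftSize_ext {W' : ℕ → ℕ} (h : W 0 = W' 0) (hf : W n % 2 = W' n % 2) :
    leftSize n W = leftSize n W' := by
  simp only [leftSize, h, hf]

end

/-! ### The data structure -/

/-- The programs. -/
def programs : ArrayPrograms where
  init := initS.compile 0
  read := powProgram ++ readS.compile 7
  write := powProgram ++ writeS.compile 7

section
variable {w n : ℕ} {s : BitVec w}

/-- The memory `M` represents the sequence `x`. -/
def Represents (M : Memory w) (x : Fin n → BitVec w) : Prop :=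
  ∀ l : Fin n, decode n (leftSize n (words M)) (words M) l = (x l).toNat

theorem words_lt (M : Memory w) (a : ℕ) : words M a < 2 ^ w := (M a).isLt

theorem bit_mul_add {M : Memory w} {a k : ℕ} (hk : k < w) :
    bit M (a * w + k) = (words M a).testBit k := by
  have h1 : (a * w + k) / w = a := by
    rw [Nat.add_comm, Nat.add_mul_div_right _ _ (by omega), Nat.div_eq_of_lt hk, Nat.zero_add]
  have h2 : (a * w + k) % w = k := by
    rw [Nat.mul_add_mod_self_right, Nat.mod_eq_of_lt hk]
  simp [bit, h1, h2, words, BitVec.getLsbD]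

theorem Represents.congr (hw : 0 < w) {M M' : Memory w} {x : Fin n → BitVec w}
    (h : ∀ i < n * w + 2, bit M i = bit M' i) (hx : Represents M x) : Represents M' x := by
  intro l
  have hn : 0 < n := l.pos
  have hwords : ∀ a < n, words M' a = words M a := by
    intro a ha
    refine Nat.eq_of_testBit_eq fun k => ?_
    by_cases hk : k < w
    · have hle : (a + 1) * w ≤ n * w := Nat.mul_le_mul_right w ha
      rw [← bit_mul_add hk, ← bit_mul_add hk, h]
      rw [Nat.add_mul] at hle
      omega
    · have hlt : ∀ M : Memory w, words M a < 2 ^ k := fun M =>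
        (words_lt M a).trans_le (Nat.pow_le_pow_right (by omega) (by omega))
      rw [Nat.testBit_lt_two_pow (hlt M), Nat.testBit_lt_two_pow (hlt M')]
  have hflag : words M' n % 2 = words M n % 2 := by
    have := h (n * w + 0) (by omega)
    rw [bit_mul_add hw, bit_mul_add hw] at this
    simp only [Nat.testBit_zero, decide_eq_decide] at this
    omega
  rw [leftSize_ext (hwords 0 hn) hflag, decode_ext hn hwords l.2]
  exact hx l

theorem bit_eq_of_le (hw : 2 ≤ w) {M M' : Memory w} (h : ∀ a, n < a → M' a = M a)
    (hn : words M' n / 2 = words M n / 2) {i : ℕ} (hi : n * w + 2 ≤ i) : bit M' i = bit M i := by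
  have hle : n ≤ i / w := (Nat.le_div_iff_mul_le (by omega)).2 (by omega)
  rcases hle.lt_or_eq with h1 | h1
  · simp [bit, h _ h1]
  · have h2 := Nat.div_add_mod' i w
    rw [← h1] at h2
    -- Bit `0` of word `n` is the flag and lies inside the area, so a bit outside it has a positive
    -- position in word `n`.
    obtain ⟨k, hk⟩ : ∃ k, i % w = k + 1 := ⟨i % w - 1, by omega⟩
    have hlt : k + 1 < w := hk ▸ Nat.mod_lt i (by omega)
    rw [← h2, hk, bit_mul_add hlt, bit_mul_add hlt, Nat.testBit_succ, Nat.testBit_succ, hn]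

/-- A final condition on a configuration that holds if the memory outside of the allocated area is
unchanged and the desired property is satisfied. -/
def Post (n : ℕ) (M : Memory w) (Q : State w → Prop) (E : Fin 16 → ℕ) (W : ℕ → ℕ) : Prop :=
  W n / 2 = words M n / 2 ∧ ∀ σ : State w, env σ.reg = E → words σ.mem = W → Q σ

theorem achieves_compile (hw : 2 ≤ w) {c : Stmt} {args : List (BitVec w)} {M : Memory w}
    {Q : State w → Prop} {T : ℕ} (hT : (c.compile 0).length ≤ T)
    (h : ∀ reg : ℕ → BitVec w, (∀ r x, args[r]? = some x → reg r = x) →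
      c.wp (2 ^ w) n (Post n M Q) (env reg) (words M)) :
    Achieves s (n * w + 2) (c.compile 0) T args M Q := by
  intro junk
  obtain ⟨r', M', ⟨k, hk, e⟩, hM', hn, hQ⟩ := c.establishes (s := s) (p := c.compile 0) rfl
    (Post n M Q) 0 (start args junk M).reg M (h _ fun r x hr => by simp [start, hr])
    ⟨[], [], by simp, rfl⟩
  refine ⟨k, hk.trans hT, _, e, ?_, fun i hi => bit_eq_of_le hw hM' hn hi, hQ _ rfl rfl⟩
  simp [State.Final]

theorem achieves_pow_compile (hw : 2 ≤ w) {c : Stmt} {d t : ℕ} (ht : t < 2 ^ w) (hn : n = d ^ t)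
    (hlt : n < 2 ^ w) {args : List (BitVec w)} {M : Memory w}
    {Q : State w → Prop} {T : ℕ} (hT : 4 * t + 4 + (c.compile 7).length ≤ T)
    (h : ∀ reg : ℕ → BitVec w, env reg 4 = n → (∀ x, args[0]? = some x → reg 2 = x) →
      (∀ x, args[1]? = some x → reg 3 = x) →
      c.wp (2 ^ w) n (Post n M Q) (env reg) (words M)) :
    Achieves s (n * w + 2) (powProgram ++ c.compile 7) T
      (BitVec.ofNat w d :: BitVec.ofNat w t :: args) M Q := by
  intro junk
  obtain ⟨r₁, e₁, k4, k2, k3⟩ := powProgram_reaches (s := s) (N := n * w + 2)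
    (post := c.compile 7) M (d := d) (t := t)
    (start (BitVec.ofNat w d :: BitVec.ofNat w t :: args) junk M).reg rfl rfl ht
  have g4 : env r₁ 4 = n := by
    change (r₁ 4).toNat = n
    rw [k4, BitVec.toNat_ofNat, ← hn, Nat.mod_eq_of_lt hlt]
  have g2 : ∀ x, args[0]? = some x → r₁ 2 = x := fun x hx => by
    rw [k2]
    simp [start, hx]
  have g3 : ∀ x, args[1]? = some x → r₁ 3 = x := fun x hx => by
    rw [k3]
    simp [start, hx]
  obtain ⟨r', M', e₂, hM', hn', hQ⟩ := c.establishes (s := s)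
    (p := powProgram ++ c.compile 7) rfl (Post n M Q) 7 r₁ M (h r₁ g4 g2 g3)
    ⟨powProgram, [], by simp, rfl⟩
  obtain ⟨k, hk, e⟩ := e₁.trans e₂
  refine ⟨k, hk.trans hT, _, e, ?_, fun i hi => bit_eq_of_le hw hM' hn' hi, hQ _ rfl rfl⟩
  simp [State.Final, powProgram]
  omega

theorem isClearableWordArray {d t T T' : ℕ} (hw : 2 ≤ w) (hB : Roomy n (2 ^ w)) (ht : t < 2 ^ w)
    (hn : n = d ^ t) (hi : (initS.compile 0).length ≤ T)
    (hr : 4 * t + 4 + (readS.compile 7).length ≤ T')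
    (hwr : 4 * t + 4 + (writeS.compile 7).length ≤ T') :
    IsClearableWordArray s programs n (n * w + 2) [BitVec.ofNat w d, BitVec.ofNat w t] T T' T' := by
  have toNat_n : (BitVec.ofNat w n).toNat = n := by
    rw [BitVec.toNat_ofNat, Nat.mod_eq_of_lt hB.lt]
  have toNat_l : ∀ l : Fin n, (BitVec.ofNat w l).toNat = l := fun l => by
    rw [BitVec.toNat_ofNat, Nat.mod_eq_of_lt (l.2.trans hB.lt)]
  have hdec : ∀ {M : Memory w} {x : Fin n → BitVec w}, Represents M x → ∀ a < n,
      decode n (leftSize n (words M)) (words M) a < 2 ^ w := fun hx a ha => by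
    rw [hx ⟨a, ha⟩]
    exact BitVec.isLt _
  refine ⟨Represents, fun M M' x h hx => hx.congr (by omega) h, fun M => ?_, fun M x hx l => ?_,
    fun M x hx l y => ?_⟩
  · refine achieves_compile hw hi fun reg hreg => ?_
    refine wp_initS hB (words_lt M) ?_ fun E' => ⟨?_, fun σ _ hσ l => ?_⟩
    · have := hreg 0 _ rfl
      change (reg 0).toNat = n
      rw [this, toNat_n]
    · have := hB.pos
      rw [initial, Function.update_of_ne (by omega), Function.update_self]
      omega
    · rw [hσ, decode_initial hB.pos l.2]
      simp
  · refine achieves_pow_compile hw ht hn hB.lt hr fun reg h4 hl _ => ?_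
    have h2 : env reg 2 = l := by
      change (reg 2).toNat = l
      rw [hl _ rfl, toNat_l]
    refine wp_readS hB (words_lt M) h4 (by rw [h2]; exact l.2) (hdec hx) fun E' h0 => ⟨rfl, ?_⟩
    rintro ⟨pc, r, M'⟩ rfl hM'
    have hM' : words M' = words M := hM'
    refine ⟨BitVec.eq_of_toNat_eq ?_, fun a => ?_⟩
    · rw [← hx l, ← h2, ← h0]
      rfl
    · change decode n (leftSize n (words M')) (words M') a = _
      rw [hM']
      exact hx a
  · refine achieves_pow_compile hw ht hn hB.lt hwr fun reg h4 hl hy => ?_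
    have h2 : env reg 2 = l := by
      change (reg 2).toNat = l
      rw [hl _ rfl, toNat_l]
    have h3 : env reg 3 = y.toNat := by
      change (reg 3).toNat = y.toNat
      rw [hy _ rfl]
    refine wp_writeS hB (words_lt M) h4 (by rw [h2]; exact l.2) (by rw [h3]; exact y.isLt)
      (hdec hx) fun E' W' hW' => ⟨hW'.1, fun σ _ hσ a => ?_⟩
    rw [hσ, hW'.2 a a.2, h2, h3]
    by_cases ha : a = l
    · subst ha
      simp
    · have : (a : ℕ) ≠ l := fun h => ha (Fin.ext h)
      rw [if_neg this, Function.update_of_ne ha]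
      exact hx a

end

/-- The universe size is `2 ^ (k * t)`, and `2 * k ≤ 2 ^ k` gives `4 * (k * t) ≤ w`. Size bounds and
divisibility then become comparisons of exponents. -/
theorem roomy_pow {w k t : ℕ} (ht : 0 < t) (h : 2 * 2 ^ k * t ≤ w) :
    Roomy ((2 ^ k) ^ t) (2 ^ w) := by
  have hk : 2 * k ≤ 2 ^ k := by
    rcases k with _ | k
    · simp
    · have : k < 2 ^ k := Nat.lt_two_pow_self
      rw [pow_succ]
      omega
  have hkt : 4 * (k * t) ≤ w := by
    calc 4 * (k * t) = 2 * (2 * k) * t := by ring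
      _ ≤ 2 * 2 ^ k * t := by gcongr
      _ ≤ w := h
  have hw : 2 ≤ w := by
    have : 0 < 2 ^ k * t := by positivity
    calc 2 ≤ 2 * (2 ^ k * t) := by omega
      _ = 2 * 2 ^ k * t := by ring
      _ ≤ w := h
  rw [← pow_mul]
  refine ⟨by positivity, ?_, dvd_pow_self 2 (by omega), ?_, ?_, ?_⟩
  · calc 2 < 2 ^ 2 := by norm_num
      _ ≤ 2 ^ w := Nat.pow_le_pow_right (by omega) hw
  · rw [← pow_add]
    exact Nat.pow_lt_pow_right (by omega) (by omega)
  · rw [← pow_add, ← pow_add]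
    exact Nat.pow_le_pow_right (by omega) (by omega)
  · rw [← pow_add]
    exact pow_dvd_pow 2 (by omega)

end ClearableArray

theorem lemma2 (c : ℝ) :
    ∃ (A : ArrayPrograms) (C : ℕ), ∀ (w d t : ℕ) (s : BitVec w), WordRAM.ApproxSqrt c s →
      (∃ k : ℕ, d = 2 ^ k) → 0 < t → 2 * d * t ≤ w →
        IsClearableWordArray s A (d ^ t) (d ^ t * w + 2) [BitVec.ofNat w d, BitVec.ofNat w t]
          C (C * t) (C * t) := by
  -- The power computation takes at most `4 * t + 4 ≤ 8 * t` steps since `t` is positive; the code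
  -- lengths bound the loop-free parts.
  refine ⟨ClearableArray.programs, 8 + (ClearableArray.initS.compile 0).length +
    (ClearableArray.readS.compile 7).length + (ClearableArray.writeS.compile 7).length, ?_⟩
  rintro w d t s - ⟨k, rfl⟩ ht h
  have h1 : t ≤ 2 ^ k * t := Nat.le_mul_of_pos_left t (by positivity)
  have h2 : 2 * t ≤ w := by
    calc 2 * t ≤ 2 * (2 ^ k * t) := by omega
      _ = 2 * 2 ^ k * t := by ring
      _ ≤ w := h
  have htw : t < 2 ^ w := lt_of_le_of_lt (by omega) Nat.lt_two_pow_self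
  refine ClearableArray.isClearableWordArray (by omega) (ClearableArray.roomy_pow ht h) htw rfl
    (by omega) ?_ ?_
  all_goals
    generalize (ClearableArray.initS.compile 0).length = a
    generalize (ClearableArray.readS.compile 7).length = b
    generalize (ClearableArray.writeS.compile 7).length = c
    nlinarith
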